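/- Let $\mathbb T=[-\pi,\pi)$ with normalized Lebesgue measure $\mu$; functions on $\mathbb T$ are identified with $2\pi$-periodic functions on $\mathbb R$. Let $X=X(\mathbb T)$ be a Banach function lattice of real- or complex-valued measurable functions, i.e. a complete normed space (where $\|f\|_X=0$ forces $f=0$ a.e.) such that: 1) if $f$ is measurable, $g\in X$ and $|f|\le|g|$ a.e., then $f\in X$ and $\|f\|_X\le\|g\|_X$; 2) if $f_n\in X$, $\sup_n\|f_n\|_X<\infty$ and $0\le f_n\uparrow f$ a.e., then $f\in X$ and $\|f_n\|_X\to\|f\|_X$; 3) for every measurable $E\subset\mathbb T$, $\chi_E\in X$ and there is $c_E>0$ with $\int_E|f|\,d\mu\le c_E\|f\|_X$ for all $f\in X$. Elements of $X$ are finite-valued functions defined at every point. For $h>0$ put $$A_hf(x)=\frac1h\int_{x-h/2}^{x+h/2}f(t)\,dt,\qquad \dot A_hf(x)=A_hf\bigl(x+\tfrac h2\bigr),$$ and assume that $A_hf\in X$ for all $f\in X$, $h>0$, and $\sup_{h>0,\ \|f\|_X\le1}\|A_hf\|_X<\infty$. Let $G_nf(x)=\sum_{k=1}^{m_n}f(x_{k,n})\varphi_{k,n}(x)$,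 $n\in\mathbb N=\{1,2,\dots\}$, where $m_n\ge1$, $\varphi_{k,n}\in X$, and the nodes satisfy, for some constants $\gamma,\gamma'>0$, $$\frac{\gamma}{n}\le x_{k+1,n}-x_{k,n}\le\frac{\gamma'}{n},\quad k=1,\dots,m_n,\ n\in\mathbb N,\qquad x_{m_n+1,n}:=2\pi+x_{1,n}.$$ Put $\|f\|_{X_n}=\bigl\|\sum_{k=1}^{m_n}|f(x_{k,n})|\chi_{[x_{k,n},x_{k+1,n})}\bigr\|_X$, where $[x_{k,n},x_{k+1,n})$ is regarded as an arc of $\mathbb T$. Let $\mathcal T_n$ be the set of trigonometric polynomials of degree at most $n$ and, for real-valued $f$, let $$\widetilde E_n(f)_X=\inf\{\|Q-q\|_X:\ Q,q\in\mathcal T_n\text{ real-valued},\ q(x)\le f(x)\le Q(x)\text{ for all }x\in\mathbb T\}.$$ Assume that there is $K_1>0$ with $$\|G_nf\|_X\le K_1\|f\|_{X_n}\quad\text{for all } f\in X,\ n\in\mathbb N. \tag{A1}$$ (i) Let $s\in\mathbb N$, and suppose that there is $K_3>0$ with $$\|T-G_nT\|_X\le K_3n^{-s}\|T^{(s)}\|_X\quad\text{for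 all } T\in\mathcal T_n,\ n\in\mathbb N. \tag{A3}$$ Then there is a constant $C>0$ such that, for every bounded measurable $f:\mathbb T\to\mathbb R$ and every $n\in\mathbb N$, $$\|f-G_nf\|_X\le C\bigl(\widetilde E_n(f)_X+\|(I-\dot A_{\gamma/n})^sf\|_X\bigr).$$ (ii) Suppose that $G_nT=T$ for all $T\in\mathcal T_n$ and $n\in\mathbb N$. Then there is a constant $C>0$ such that, for every bounded measurable $f:\mathbb T\to\mathbb R$ and every $n\in\mathbb N$, $$\|f-G_nf\|_X\le C\,\widetilde E_n(f)_X.$$ -/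

import Mathlib

open MeasureTheory Filter Topology
open scoped ENNReal NNReal

noncomputable section

/-- The normalized Lebesgue measure on the circle `𝕋`, the latter identified with `[-π, π)`.
Functions on `𝕋` are `2π`-periodic functions on `ℝ`. -/
def circleMeasure : Measure ℝ :=
  (ENNReal.ofReal (2 * Real.pi))⁻¹ • volume.restrict (Set.Ico (-Real.pi) Real.pi)

/-- A real-valued function regarded as a `𝕜`-valued one. -/
def liftK (𝕜 : Type*) [RCLike 𝕜] (f : ℝ → ℝ) : ℝ → 𝕜 := fun x => ((f x : ℝ) : 𝕜)

/-- A Banach function lattice `X(𝕋)` of real (`𝕜 = ℝ`) or complex (`𝕜 = ℂ`) valued functions with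
the Fatou property. Its elements are genuine functions, with a value at every point. The norm is
recorded on all functions `ℝ → 𝕜`, with the value `∞` exactly outside `X`. As usual for spaces over
a measure, inequalities between functions in the axioms are meant almost everywhere. -/
structure BanachFunctionLattice (𝕜 : Type*) [RCLike 𝕜] where
  /-- `‖f‖_X`, with value `∞` if `f ∉ X`. -/
  eNorm : (ℝ → 𝕜) → ℝ≥0∞
  /-- Elements of `X` are functions on the circle. -/
  periodic' : ∀ f, eNorm f < ∞ → Function.Periodic f (2 * Real.pi)
  /-- Elements of `X` are (Lebesgue) measurable. -/
  aestronglyMeasurable' : ∀ f, eNorm f < ∞ → AEStronglyMeasurable f circleMeasure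
  eNorm_add_le' : ∀ f g, eNorm (f + g) ≤ eNorm f + eNorm g
  eNorm_smul' : ∀ (c : 𝕜) (f : ℝ → 𝕜), eNorm (c • f) = ‖c‖ₑ * eNorm f
  ae_eq_zero_of_eNorm_eq_zero' : ∀ f, eNorm f = 0 → f =ᵐ[circleMeasure] 0
  /-- Completeness. -/
  complete' : ∀ F : ℕ → ℝ → 𝕜, (∀ n, eNorm (F n) < ∞) →
    (∀ ε : ℝ≥0∞, 0 < ε → ∃ N, ∀ i ≥ N, ∀ j ≥ N, eNorm (F i - F j) < ε) →
    ∃ g, eNorm g < ∞ ∧ Tendsto (fun n => eNorm (F n - g)) atTop (𝓝 0)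
  /-- Lattice property: if `f` is measurable, `g ∈ X` and `|f| ≤ |g|`, then `f ∈ X` and
  `‖f‖_X ≤ ‖g‖_X`. -/
  solid' : ∀ f g, Function.Periodic f (2 * Real.pi) → AEStronglyMeasurable f circleMeasure →
    eNorm g < ∞ → (∀ᵐ x ∂circleMeasure, ‖f x‖ ≤ ‖g x‖) → eNorm f ≤ eNorm g
  /-- Fatou property: if `f_n ∈ X`, `sup_n ‖f_n‖_X < ∞` and `0 ≤ f_n ↑ f`, then `f ∈ X` and
  `‖f_n‖_X → ‖f‖_X`. -/
  fatou' : ∀ (F : ℕ → ℝ → ℝ) (f : ℝ → ℝ), (⨆ n, eNorm (liftK 𝕜 (F n))) < ∞ →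
    Function.Periodic f (2 * Real.pi) →
    (∀ᵐ x ∂circleMeasure, 0 ≤ F 0 x ∧ Monotone (fun n => F n x) ∧
      Tendsto (fun n => F n x) atTop (𝓝 (f x))) →
    eNorm (liftK 𝕜 f) < ∞ ∧
      Tendsto (fun n => eNorm (liftK 𝕜 (F n))) atTop (𝓝 (eNorm (liftK 𝕜 f)))
  /-- For measurable `E ⊆ 𝕋` (a `2π`-periodic set), `χ_E ∈ X` and `∫_E |f| dμ ≤ c_E ‖f‖_X`. -/
  indicator' : ∀ E : Set ℝ, (∀ x, x + 2 * Real.pi ∈ E ↔ x ∈ E) →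
    NullMeasurableSet E circleMeasure →
    eNorm (E.indicator (fun _ => (1 : 𝕜))) < ∞ ∧
      ∃ c : ℝ≥0, 0 < c ∧ ∀ f, eNorm f < ∞ → ∫⁻ x in E, ‖f x‖ₑ ∂circleMeasure ≤ c * eNorm f

/-- The Steklov average `A_h f(x) = (1/h) ∫_{x-h/2}^{x+h/2} f(t) dt`. -/
def steklov {𝕜 : Type*} [RCLike 𝕜] (h : ℝ) (f : ℝ → 𝕜) : ℝ → 𝕜 :=
  fun x => (1 / h : ℝ) • ∫ t in (x - h / 2)..(x + h / 2), f t

/-- The shifted Steklov average `Ȧ_h f(x) = A_h f(x + h/2)`. -/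
def steklovDot {𝕜 : Type*} [RCLike 𝕜] (h : ℝ) (f : ℝ → 𝕜) : ℝ → 𝕜 :=
  fun x => steklov h f (x + h / 2)

/-- The `s`-fold application `(I - Ȧ_h)^s f`. -/
def steklovDotDiff {𝕜 : Type*} [RCLike 𝕜] (h : ℝ) (s : ℕ) (f : ℝ → 𝕜) : ℝ → 𝕜 :=
  (fun g : ℝ → 𝕜 => g - steklovDot h g)^[s] f

/-- `𝒯_n`: trigonometric polynomials of degree at most `n` with coefficients in `𝕜`. -/
def trigPoly (𝕜 : Type*) [RCLike 𝕜] (n : ℕ) : Submodule 𝕜 (ℝ → 𝕜) :=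
  Submodule.span 𝕜 {g | ∃ k : ℕ, k ≤ n ∧
    (g = liftK 𝕜 (fun x => Real.cos (k * x)) ∨ g = liftK 𝕜 (fun x => Real.sin (k * x)))}

/-- The arc `[a, b)` of the circle, as a `2π`-periodic subset of `ℝ`. -/
def arc (a b : ℝ) : Set ℝ := {t | ∃ j : ℤ, t + j * (2 * Real.pi) ∈ Set.Ico a b}

namespace BanachFunctionLattice

variable {𝕜 : Type*} [RCLike 𝕜]

/-- Membership `f ∈ X`. -/
def Mem (X : BanachFunctionLattice 𝕜) (f : ℝ → 𝕜) : Prop := X.eNorm f < ∞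

/-- The Steklov averages `A_h`, `h > 0`, map `X` to `X` and are uniformly bounded. -/
def SteklovBounded (X : BanachFunctionLattice 𝕜) : Prop :=
  (∀ f, X.Mem f → ∀ h : ℝ, 0 < h → X.Mem (steklov h f)) ∧
  ∃ C : ℝ≥0, ∀ f, X.eNorm f ≤ 1 → ∀ h : ℝ, 0 < h → X.eNorm (steklov h f) ≤ C

/-- The error of best one-sided approximation `Ẽ_n(f)_X` of a real-valued `f`. -/
def oneSidedError (X : BanachFunctionLattice 𝕜) (n : ℕ) (f : ℝ → ℝ) : ℝ≥0∞ :=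
  ⨅ (Q ∈ trigPoly ℝ n) (q ∈ trigPoly ℝ n) (_ : ∀ x, q x ≤ f x ∧ f x ≤ Q x),
    X.eNorm (liftK 𝕜 (Q - q))

end BanachFunctionLattice

/-- The data of a sequence of linear sampling operators
`G_n f = ∑_{k=1}^{m_n} f(x_{k,n}) φ_{k,n}`, `n ≥ 1`, with `φ_{k,n} ∈ X` and nodes satisfying
`γ/n ≤ x_{k+1,n} - x_{k,n} ≤ γ'/n` for `1 ≤ k ≤ m_n`, where `x_{m_n+1,n} = 2π + x_{1,n}`. The nodes
are points of the circle, given by increasing real representatives within one period. -/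
structure SamplingOperators {𝕜 : Type*} [RCLike 𝕜] (X : BanachFunctionLattice 𝕜) where
  m : ℕ → ℕ
  node : ℕ → ℕ → ℝ
  φ : ℕ → ℕ → ℝ → 𝕜
  γ : ℝ
  γ' : ℝ
  γ_pos : 0 < γ
  γ'_pos : 0 < γ'
  m_pos : ∀ n, 1 ≤ n → 1 ≤ m n
  node_wrap : ∀ n, 1 ≤ n → node n (m n + 1) = 2 * Real.pi + node n 1
  node_gap : ∀ n, 1 ≤ n → ∀ k ∈ Finset.Icc 1 (m n),
    γ / n ≤ node n (k + 1) - node n k ∧ node n (k + 1) - node n k ≤ γ' / n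
  φ_mem : ∀ n, 1 ≤ n → ∀ k ∈ Finset.Icc 1 (m n), X.Mem (φ n k)

namespace SamplingOperators

variable {𝕜 : Type*} [RCLike 𝕜] {X : BanachFunctionLattice 𝕜}

/-- `G_n f(x) = ∑_{k=1}^{m_n} f(x_{k,n}) φ_{k,n}(x)`. -/
def op (G : SamplingOperators X) (n : ℕ) (f : ℝ → 𝕜) : ℝ → 𝕜 :=
  fun x => ∑ k ∈ Finset.Icc 1 (G.m n), f (G.node n k) * G.φ n k x

/-- The semi-norm `‖f‖_{X_n} = ‖∑_{k=1}^{m_n} |f(x_k)| χ_{[x_k, x_{k+1})}‖_X`. -/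
def nodeNorm (G : SamplingOperators X) (n : ℕ) (f : ℝ → 𝕜) : ℝ≥0∞ :=
  X.eNorm (liftK 𝕜 (fun t => ∑ k ∈ Finset.Icc 1 (G.m n),
    (arc (G.node n k) (G.node n (k + 1))).indicator (fun _ => ‖f (G.node n k)‖) t))

/-- `‖G_n f‖_X ≤ K ‖f‖_{X_n}` for all `f ∈ X` and `n ≥ 1`. -/
def Stable (G : SamplingOperators X) : Prop :=
  ∃ K : ℝ≥0, 0 < K ∧ ∀ n : ℕ, 1 ≤ n → ∀ f, X.Mem f → X.eNorm (G.op n f) ≤ K * G.nodeNorm n f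

/-- `‖T - G_n T‖_X ≤ K n^{-s} ‖T^{(s)}‖_X` for all `T ∈ 𝒯_n` and `n ≥ 1`. -/
def PolyAccurate (G : SamplingOperators X) (s : ℕ) : Prop :=
  ∃ K : ℝ≥0, 0 < K ∧ ∀ n : ℕ, 1 ≤ n → ∀ T ∈ trigPoly 𝕜 n,
    X.eNorm (T - G.op n T) ≤ K * ((n : ℝ≥0∞) ^ s)⁻¹ * X.eNorm (iteratedDeriv s T)

/-- `G_n T = T` for all `T ∈ 𝒯_n` and `n ≥ 1`. -/
def Reproduces (G : SamplingOperators X) : Prop :=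
  ∀ n : ℕ, 1 ≤ n → ∀ T ∈ trigPoly 𝕜 n, G.op n T = T

end SamplingOperators

end

/-! ### Fourier multipliers and kernels of quadratic decay. -/

section Kernel

open scoped FourierTransform ContDiff

/-! For `q ≤ f ≤ Q` split `f - Gf = (f - q) + (q - Gq) + G(q - f)`. The first term is dominated by
`Q - q`. So is `|q - f|` at every node, and stability reduces the last term to a
Marcinkiewicz–Zygmund bound for the polynomial `Q - q` (`exists_nodeNorm_le`). The middle term
vanishes if polynomials are reproduced. Otherwise it is at most `K n^{-s} ‖q^{(s)}‖`; a
Nikolskii–Stechkin inequality turns this into a multiple of the norm of `(I - Ȧ_{γ/n})^s q`, and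
replacing `q` by `f` costs a multiple of `‖Q - q‖`.

Both polynomial inequalities rest on `exists_iteratedDeriv_le_integral`. On `e^{ikx}` the operator
`I - Ȧ_h` acts as `-zE(z)` with `z = ikh` and `e^z = 1 + z + z²E(z)`. As `E` has no zeros on the
imaginary axis, the quotient of the symbols of `d^s/dx^s` and `(I - Ȧ_{γ/n})^s` is `n^s` times a
smooth function of `k/n`, which on `[-1, 1]` is the Fourier transform of a kernel bounded by a
multiple of `1/(1 + v²)`. The case `s = 0` is a reproducing estimate for polynomials.

Convolution with `1/(1 + v²)` at scale `1/n` is bounded in `X` because a dyadic decomposition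
majorizes it by Steklov averages (`realNorm_convolution_le`). This needs no boundedness of
translations. -/

/-- The second divided difference of the exponential at the origin is an entire function without
zeros on the imaginary axis. -/
theorem exists_exp_second_dslope : ∃ E : ℂ → ℂ, Differentiable ℂ E ∧
    (∀ z, Complex.exp z = 1 + z + z ^ 2 * E z) ∧ ∀ t : ℝ, E (t * Complex.I) ≠ 0 := by
  have hd : ∀ f : ℂ → ℂ, Differentiable ℂ f → Differentiable ℂ (dslope f 0) := by
    intro f hf
    rw [← differentiableOn_univ] at hf ⊢
    exact (Complex.differentiableOn_dslope univ_mem).2 hf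
  have hs : ∀ (f : ℂ → ℂ) z, f z = f 0 + z * dslope f 0 z := by
    intro f z
    have := sub_smul_dslope f 0 z
    simp only [sub_zero, smul_eq_mul] at this
    rw [this]; ring
  set E₁ := dslope Complex.exp 0 with hE₁
  have hE₁d : Differentiable ℂ E₁ := hd _ Complex.differentiable_exp
  have hE₂d := hd _ hE₁d
  have h0 : E₁ 0 = 1 := by simp [hE₁, dslope_same]
  have hexp : ∀ z, Complex.exp z = 1 + z + z ^ 2 * dslope E₁ 0 z := by
    intro z
    have h1 := hs Complex.exp z
    have h2 := hs E₁ z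
    rw [Complex.exp_zero] at h1
    rw [h0] at h2
    rw [h1, ← hE₁, h2]; ring
  refine ⟨dslope E₁ 0, hE₂d, hexp, fun t => ?_⟩
  by_cases ht : t = 0
  · subst ht
    -- The value at the origin is a limit along the positive reals, where `e^x ≥ 1 + x + x²/2` gives
    -- the lower bound `1/2`.
    have hre : ∀ x : ℝ, 0 < x → 1 / 2 ≤ (dslope E₁ 0 (x : ℂ)).re := by
      intro x hx
      have h1 := congrArg Complex.re (hexp x)
      rw [← Complex.ofReal_exp, ← Complex.ofReal_pow] at h1
      simp only [Complex.add_re, Complex.one_re, Complex.ofReal_re, Complex.re_ofReal_mul] at h1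
      have h2 := Real.quadratic_le_exp_of_nonneg hx.le
      have h3 : x ^ 2 * (1 / 2) ≤ x ^ 2 * (dslope E₁ 0 (x : ℂ)).re := by linarith
      exact le_of_mul_le_mul_left h3 (by positivity)
    have hlim : Tendsto (fun x : ℝ => (dslope E₁ 0 (x : ℂ)).re) (𝓝[>] 0)
        (𝓝 (dslope E₁ 0 ((0 : ℝ) : ℂ)).re) := by
      have hc : Continuous fun x : ℝ => (dslope E₁ 0 (x : ℂ)).re :=
        Complex.continuous_re.comp (hE₂d.continuous.comp Complex.continuous_ofReal)
      exact (hc.tendsto 0).mono_left nhdsWithin_le_nhds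
    have h4 : 1 / 2 ≤ (dslope E₁ 0 ((0 : ℝ) : ℂ)).re :=
      ge_of_tendsto hlim (eventually_nhdsWithin_of_forall fun x hx => hre x hx)
    intro h5
    rw [Complex.ofReal_zero, zero_mul] at h5
    rw [Complex.ofReal_zero, h5] at h4
    norm_num at h4
  -- A zero at `it` would force `e^{it} = 1 + it`, whose right side has modulus greater than `1`.
  · intro h
    have h1 := hexp (t * Complex.I)
    rw [h, mul_zero, add_zero] at h1
    have hre := congrArg Complex.re h1
    have him := congrArg Complex.im h1
    rw [Complex.exp_ofReal_mul_I_re] at hre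
    rw [Complex.exp_ofReal_mul_I_im] at him
    simp at hre him
    have := Real.sin_sq_add_cos_sq t
    rw [hre, him] at this
    exact ht (by nlinarith)

/-- Every smooth function agrees on `[-1, 1]` with the Fourier transform of a kernel of quadratic
decay. -/
theorem exists_kernel_of_contDiff {m : ℝ → ℂ} (hm : ContDiff ℝ ∞ m) :
    ∃ (K : ℝ → ℂ) (C : ℝ), Continuous K ∧ 0 < C ∧ (∀ v, ‖K v‖ ≤ C * (1 + v ^ 2)⁻¹) ∧
      ∀ ξ : ℝ, |ξ| ≤ 1 → ∫ v : ℝ, Complex.exp (-(ξ * v * Complex.I)) * K v = m ξ := by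
  -- The factor `2π` matches the normalization `e^{-2πivη}` of the Fourier transform; `|ξ| ≤ 1`
  -- becomes `|η| ≤ 1/(2π)`, where the bump equals `1`.
  let b : ContDiffBump (0 : ℝ) := ⟨1, 2, one_pos, one_lt_two⟩
  let F : ℝ → ℂ := fun η => (b η : ℂ) * m (2 * Real.pi * η)
  have hFs : ContDiff ℝ ∞ F := by
    apply ContDiff.mul
    · exact Complex.ofRealCLM.contDiff.comp b.contDiff
    · exact hm.comp (contDiff_const.mul contDiff_id)
  have hFc : HasCompactSupport F := by
    apply HasCompactSupport.mul_right
    exact b.hasCompactSupport.comp_left (g := fun x : ℝ => (x : ℂ)) (by simp)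
  let φ : SchwartzMap ℝ ℂ := hFc.toSchwartzMap hFs
  let K : SchwartzMap ℝ ℂ := 𝓕⁻ φ
  have hK : 𝓕 (K : ℝ → ℂ) = F := by
    have : 𝓕 K = φ := FourierTransform.fourier_fourierInv_eq φ
    rw [← SchwartzMap.fourier_coe, this]; rfl
  obtain ⟨C₀, hC₀⟩ := K.decay 0 0
  obtain ⟨C₂, hC₂⟩ := K.decay 2 0
  refine ⟨K, C₀ + C₂, K.continuous, by linarith [hC₀.1, hC₂.1], fun v => ?_, fun ξ hξ => ?_⟩
  · have h0 := hC₀.2 v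
    have h2 := hC₂.2 v
    simp only [norm_iteratedFDeriv_zero, pow_zero, one_mul, Real.norm_eq_abs, sq_abs] at h0 h2
    rw [← div_eq_mul_inv, le_div_iff₀ (by positivity)]
    linarith
  · have h := congrFun hK (ξ / (2 * Real.pi))
    rw [Real.fourier_real_eq_integral_exp_smul] at h
    have hpi := Real.pi_pos
    have hb : b (ξ / (2 * Real.pi)) = 1 := by
      apply b.one_of_mem_closedBall
      rw [mem_closedBall_zero_iff, Real.norm_eq_abs, abs_div, abs_of_pos (by positivity : 0 < 2 * Real.pi)]
      rw [div_le_iff₀ (by positivity)]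
      change |ξ| ≤ 1 * _
      linarith [Real.pi_gt_three]
    have hF : F (ξ / (2 * Real.pi)) = m ξ := by
      simp only [F, hb]
      rw [mul_div_cancel₀ _ (by positivity)]; simp
    rw [hF] at h
    rw [← h]
    refine integral_congr_ae (Eventually.of_forall fun v => ?_)
    simp only [smul_eq_mul]; congr 2
    push_cast
    have : (Real.pi : ℂ) ≠ 0 := by exact_mod_cast hpi.ne'
    field_simp

end Kernel

/-! ### Trigonometric polynomials as exponential sums. -/

section ExpSum

open scoped ContDiff

/-- The exponential sum `∑_{|k| ≤ n} c_k e^{ikx}`. -/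
noncomputable def expSum (n : ℕ) (c : ℤ → ℂ) (x : ℝ) : ℂ :=
  ∑ k ∈ Finset.Icc (-(n : ℤ)) n, c k * Complex.exp (k * x * Complex.I)

theorem expSum_add (n : ℕ) (c d : ℤ → ℂ) (x : ℝ) :
    expSum n (c + d) x = expSum n c x + expSum n d x := by
  simp [expSum, add_mul, Finset.sum_add_distrib]

theorem expSum_sub (n : ℕ) (c d : ℤ → ℂ) (x : ℝ) :
    expSum n (c - d) x = expSum n c x - expSum n d x := by
  simp [expSum, sub_mul, Finset.sum_sub_distrib]

theorem expSum_smul (n : ℕ) (a : ℂ) (c : ℤ → ℂ) (x : ℝ) :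
    expSum n (a • c) x = a * expSum n c x := by
  simp [expSum, Finset.mul_sum, mul_assoc]

theorem expSum_single {n : ℕ} {k : ℤ} (hk : k ∈ Finset.Icc (-(n : ℤ)) n) (x : ℝ) :
    expSum n (Pi.single k 1) x = Complex.exp (k * x * Complex.I) := by
  rw [expSum, Finset.sum_eq_single_of_mem k hk]
  · simp
  · intro j _ hj
    simp [Pi.single_eq_of_ne hj]

/-- Euler's formulas. In exponential form, differentiation, averaging and convolution all act on the
coefficients by multiplication. -/
theorem exists_expSum_of_mem_trigPoly {n : ℕ} {q : ℝ → ℝ} (hq : q ∈ trigPoly ℝ n) :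
    ∃ c, ∀ x, (q x : ℂ) = expSum n c x := by
  induction hq using Submodule.span_induction with
  | mem g hg =>
    obtain ⟨k, hk, hg⟩ := hg
    have h1 : (k : ℤ) ∈ Finset.Icc (-(n : ℤ)) n := by rw [Finset.mem_Icc]; omega
    have h2 : (-(k : ℤ)) ∈ Finset.Icc (-(n : ℤ)) n := by rw [Finset.mem_Icc]; omega
    rcases hg with rfl | rfl
    · refine ⟨(1 / 2 : ℂ) • (Pi.single (k : ℤ) 1 + Pi.single (-(k : ℤ)) 1), fun x => ?_⟩
      rw [expSum_smul, expSum_add, expSum_single h1, expSum_single h2]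
      simp [liftK, Complex.cos]
      ring
    · refine ⟨(-Complex.I / 2 : ℂ) • (Pi.single (k : ℤ) 1 - Pi.single (-(k : ℤ)) 1), fun x => ?_⟩
      rw [expSum_smul, expSum_sub, expSum_single h1, expSum_single h2]
      simp [liftK, Complex.sin]
      ring
  | zero => exact ⟨0, fun x => by simp [expSum]⟩
  | add f g _ _ hf hg =>
    obtain ⟨c, hc⟩ := hf
    obtain ⟨d, hd⟩ := hg
    exact ⟨c + d, fun x => by rw [expSum_add, ← hc, ← hd]; simp⟩
  | smul a f _ hf =>
    obtain ⟨c, hc⟩ := hf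
    exact ⟨(a : ℂ) • c, fun x => by rw [expSum_smul, ← hc]; simp⟩

theorem continuous_expSum (n : ℕ) (c : ℤ → ℂ) : Continuous (expSum n c) := by
  unfold expSum
  fun_prop

theorem hasDerivAt_expSum (n : ℕ) (c : ℤ → ℂ) (x : ℝ) :
    HasDerivAt (expSum n c) (expSum n (fun k => k * Complex.I * c k) x) x := by
  unfold expSum
  refine HasDerivAt.fun_sum fun k _ => ?_
  have h : HasDerivAt (fun x : ℝ => (k * x * Complex.I : ℂ)) (k * Complex.I) x := by
    simpa using ((Complex.ofRealCLM.hasDerivAt (x := x)).const_mul (k : ℂ)).mul_const Complex.I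
  exact (h.cexp.const_mul (c k)).congr_deriv (by ring)

theorem continuous_of_eq_expSum {n : ℕ} {c : ℤ → ℂ} {q : ℝ → ℝ}
    (hq : ∀ x, (q x : ℂ) = expSum n c x) : Continuous q := by
  have h : q = fun x => (expSum n c x).re := by
    ext x; rw [← hq, Complex.ofReal_re]
  rw [h]
  exact Complex.continuous_re.comp (continuous_expSum n c)

theorem periodic_of_eq_expSum {n : ℕ} {c : ℤ → ℂ} {q : ℝ → ℝ}
    (hq : ∀ x, (q x : ℂ) = expSum n c x) : Function.Periodic q (2 * Real.pi) := by
  intro x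
  have h : (q (x + 2 * Real.pi) : ℂ) = q x := by
    rw [hq, hq]
    unfold expSum
    refine Finset.sum_congr rfl fun k _ => ?_
    congr 1
    rw [Complex.exp_eq_exp_iff_exists_int]
    exact ⟨k, by push_cast; ring⟩
  exact_mod_cast h

theorem hasDerivAt_of_eq_expSum {n : ℕ} {c : ℤ → ℂ} {q : ℝ → ℝ}
    (hq : ∀ x, (q x : ℂ) = expSum n c x) (x : ℝ) :
    HasDerivAt q (expSum n (fun k => k * Complex.I * c k) x).re x := by
  have h : q = fun x => (expSum n c x).re := by
    ext x; rw [← hq, Complex.ofReal_re]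
  rw [h]
  exact Complex.reCLM.hasFDerivAt.comp_hasDerivAt x (hasDerivAt_expSum n c x)

theorem deriv_of_eq_expSum {n : ℕ} {c : ℤ → ℂ} {q : ℝ → ℝ}
    (hq : ∀ x, (q x : ℂ) = expSum n c x) (x : ℝ) :
    ((deriv q x : ℝ) : ℂ) = expSum n (fun k => k * Complex.I * c k) x := by
  have h1 := hasDerivAt_of_eq_expSum hq x
  have h2 : HasDerivAt (fun x => (q x : ℂ)) _ x := h1.ofReal_comp
  rw [funext hq] at h2
  rw [h1.deriv]
  exact h2.unique (hasDerivAt_expSum n c x)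

theorem iteratedDeriv_of_eq_expSum {n : ℕ} {c : ℤ → ℂ} {q : ℝ → ℝ}
    (hq : ∀ x, (q x : ℂ) = expSum n c x) (s : ℕ) (x : ℝ) :
    ((iteratedDeriv s q x : ℝ) : ℂ) = expSum n (fun k => (k * Complex.I) ^ s * c k) x := by
  induction s generalizing x with
  | zero => simp [hq]
  | succ s ih =>
    rw [iteratedDeriv_succ, deriv_of_eq_expSum ih]
    congr 1; ext k; ring

theorem iteratedDeriv_liftK {𝕜 : Type*} [RCLike 𝕜] {n : ℕ} {c : ℤ → ℂ} {q : ℝ → ℝ}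
    (hq : ∀ x, (q x : ℂ) = expSum n c x) (s : ℕ) :
    iteratedDeriv s (liftK 𝕜 q) = liftK 𝕜 (iteratedDeriv s q) := by
  induction s with
  | zero => simp
  | succ s ih =>
    ext x
    have h := (hasDerivAt_of_eq_expSum (iteratedDeriv_of_eq_expSum hq s) x).differentiableAt
    have h2 : HasDerivAt (liftK 𝕜 (iteratedDeriv s q)) _ x :=
      (RCLike.ofRealCLM (K := 𝕜)).hasFDerivAt.comp_hasDerivAt x h.hasDerivAt
    rw [iteratedDeriv_succ, ih, h2.deriv, liftK, iteratedDeriv_succ]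
    simp

theorem steklovDot_eq {𝕜 : Type*} [RCLike 𝕜] (h : ℝ) (f : ℝ → 𝕜) (x : ℝ) :
    steklovDot h f x = (1 / h : ℝ) • ∫ t in x..(x + h), f t := by
  simp only [steklovDot, steklov]
  congr 2 <;> ring

/-- The symbol of the forward average is `(e^z - 1)/z` at `z = ikh`; writing it as `1 + zE(z)` also
covers the frequency `k = 0`. -/
theorem integral_exp_average {E : ℂ → ℂ} (hE : ∀ z, Complex.exp z = 1 + z + z ^ 2 * E z)
    {h : ℝ} (hh : 0 < h) (k : ℤ) (x : ℝ) :
    (1 / h : ℂ) * ∫ t in x..(x + h), Complex.exp (k * t * Complex.I) =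
      (1 + k * h * Complex.I * E (k * h * Complex.I)) * Complex.exp (k * x * Complex.I) := by
  have hh' : (h : ℂ) ≠ 0 := by exact_mod_cast hh.ne'
  by_cases hk : k = 0
  · subst hk
    simp [hh']
  · have hk' : (k : ℂ) ≠ 0 := by exact_mod_cast hk
    have hc : (k * Complex.I : ℂ) ≠ 0 := mul_ne_zero hk' Complex.I_ne_zero
    have h1 : (fun t : ℝ => Complex.exp (k * t * Complex.I)) =
        fun t : ℝ => Complex.exp (k * Complex.I * t) := by
      ext t; ring_nf
    rw [h1, integral_exp_mul_complex hc]
    have h2 : (k * Complex.I * ((x + h : ℝ) : ℂ) : ℂ) = k * x * Complex.I + k * h * Complex.I := by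
      push_cast; ring
    rw [h2, Complex.exp_add, hE (k * h * Complex.I), mul_right_comm (k : ℂ) Complex.I x]
    field_simp
    ring

theorem steklovDotDiff_succ {𝕜 : Type*} [RCLike 𝕜] (h : ℝ) (s : ℕ) (f : ℝ → 𝕜) :
    steklovDotDiff h (s + 1) f = steklovDotDiff h s f - steklovDot h (steklovDotDiff h s f) := by
  simp only [steklovDotDiff, Function.iterate_succ_apply']

theorem steklovDot_of_eq_expSum {E : ℂ → ℂ} (hE : ∀ z, Complex.exp z = 1 + z + z ^ 2 * E z)
    {h : ℝ} (hh : 0 < h) {n : ℕ} {c : ℤ → ℂ} {q : ℝ → ℝ} (hq : ∀ x, (q x : ℂ) = expSum n c x)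
    (x : ℝ) :
    ((steklovDot h q x : ℝ) : ℂ) =
      expSum n (fun k => (1 + k * h * Complex.I * E (k * h * Complex.I)) * c k) x := by
  rw [steklovDot_eq, smul_eq_mul, Complex.ofReal_mul, ← intervalIntegral.integral_ofReal]
  simp_rw [hq]
  unfold expSum
  rw [intervalIntegral.integral_finsetSum
    (fun k _ => Continuous.intervalIntegrable (by fun_prop) _ _), Finset.mul_sum]
  refine Finset.sum_congr rfl fun k _ => ?_
  rw [intervalIntegral.integral_const_mul, mul_left_comm]
  push_cast
  rw [integral_exp_average hE hh]
  ring

theorem steklovDotDiff_of_eq_expSum {E : ℂ → ℂ} (hE : ∀ z, Complex.exp z = 1 + z + z ^ 2 * E z)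
    {h : ℝ} (hh : 0 < h) {n : ℕ} {c : ℤ → ℂ} {q : ℝ → ℝ} (hq : ∀ x, (q x : ℂ) = expSum n c x)
    (s : ℕ) (x : ℝ) :
    ((steklovDotDiff h s q x : ℝ) : ℂ) =
      expSum n (fun k => (-(k * h * Complex.I * E (k * h * Complex.I))) ^ s * c k) x := by
  induction s generalizing x with
  | zero => simp [steklovDotDiff, hq]
  | succ s ih =>
    rw [steklovDotDiff_succ, Pi.sub_apply, Complex.ofReal_sub, steklovDot_of_eq_expSum hE hh ih, ih,
      ← expSum_sub]
    congr 1; ext k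
    simp only [Pi.sub_apply]
    ring

theorem integrable_of_quadratic_decay {K : ℝ → ℂ} (hK : Continuous K) {C : ℝ}
    (hC : ∀ v, ‖K v‖ ≤ C * (1 + v ^ 2)⁻¹) : Integrable K :=
  (integrable_inv_one_add_sq.const_mul C).mono' hK.aestronglyMeasurable
    (Eventually.of_forall hC)

/-- Degree at most `n` puts every rescaled frequency `k/n` in `[-1, 1]`, the only range where the
transform of `K` is known. -/
theorem integral_expSum_mul_kernel {K : ℝ → ℂ} (hKi : Integrable K) {m : ℝ → ℂ}
    (hKm : ∀ ξ : ℝ, |ξ| ≤ 1 → ∫ v : ℝ, Complex.exp (-(ξ * v * Complex.I)) * K v = m ξ)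
    {n : ℕ} (hn : 1 ≤ n) (c : ℤ → ℂ) (y : ℝ) :
    ∫ v : ℝ, expSum n c (y - v / n) * K v = expSum n (fun k => m (k / n) * c k) y := by
  have hn' : (0 : ℝ) < n := by exact_mod_cast hn
  unfold expSum
  simp_rw [Finset.sum_mul]
  rw [integral_finsetSum]
  · refine Finset.sum_congr rfl fun k hk => ?_
    have hk1 : |((k / n : ℝ))| ≤ 1 := by
      rw [abs_div, abs_of_pos hn', div_le_one hn']
      rw [Finset.mem_Icc] at hk
      rw [abs_le]
      constructor
      · exact_mod_cast hk.1
      · exact_mod_cast hk.2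
    rw [← hKm _ hk1]
    have h1 : ∀ v : ℝ, c k * Complex.exp (k * ((y - v / n : ℝ) : ℂ) * Complex.I) * K v =
        (c k * Complex.exp (k * y * Complex.I)) *
          (Complex.exp (-(((k / n : ℝ) : ℂ) * v * Complex.I)) * K v) := by
      intro v
      have : (k * ((y - v / n : ℝ) : ℂ) * Complex.I : ℂ) =
          k * y * Complex.I + -(((k / n : ℝ) : ℂ) * v * Complex.I) := by
        push_cast; ring
      rw [this, Complex.exp_add]; ring
    simp_rw [h1]
    rw [integral_const_mul]
    ring
  · intro k _
    have h2 : Integrable fun v : ℝ =>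
        Complex.exp (k * ((y - v / n : ℝ) : ℂ) * Complex.I) * K v := by
      refine hKi.bdd_mul (c := 1) (Continuous.aestronglyMeasurable (by fun_prop)) ?_
      refine Eventually.of_forall fun v => ?_
      have : (k * ((y - v / n : ℝ) : ℂ) * Complex.I : ℂ) = ((k * (y - v / n) : ℝ) : ℂ) * Complex.I := by
        push_cast; ring
      rw [this, Complex.norm_exp_ofReal_mul_I]
    simpa [mul_assoc] using h2.const_mul (c k)

/-- The derivative of order `s` of a trigonometric polynomial `q` of degree `n` is controlled by
a convolution of `|(I - Ȧ_{γ/n})^s q|` with a kernel of quadratic decay at scale `1/n`. -/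
theorem exists_iteratedDeriv_le_integral {γ : ℝ} (hγ : 0 < γ) (s : ℕ) :
    ∃ C : ℝ, 0 < C ∧ ∀ n : ℕ, 1 ≤ n → ∀ q ∈ trigPoly ℝ n, ∀ y : ℝ,
      |iteratedDeriv s q y| ≤
        C * n ^ s * ∫ v : ℝ, |steklovDotDiff (γ / n) s q (y - v / n)| * (1 + v ^ 2)⁻¹ := by
  obtain ⟨E, hEd, hE, hE0⟩ := exists_exp_second_dslope
  -- With `z = ikγ/n` one has `ik = zn/γ`, so `(ik)^s / (-zE(z))^s = n^s (-1/(γE(z)))^s`: the zero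
  -- at `z = 0` cancels and the rest is `m(k/n)`.
  let m : ℝ → ℂ := fun ξ => (-(γ * E ((γ * ξ : ℝ) * Complex.I))⁻¹) ^ s
  have hm : ContDiff ℝ ∞ m := by
    have h1 : ContDiff ℝ ∞ E := (hEd.contDiff (n := ∞)).restrict_scalars ℝ
    have h2 : ContDiff ℝ ∞ fun ξ : ℝ => (((γ * ξ : ℝ) : ℂ) * Complex.I) :=
      (Complex.ofRealCLM.contDiff.comp (contDiff_const.mul contDiff_id)).mul contDiff_const
    refine ContDiff.pow (ContDiff.neg (ContDiff.inv (contDiff_const.mul (h1.comp h2)) ?_)) s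
    intro ξ
    exact mul_ne_zero (by exact_mod_cast hγ.ne') (hE0 _)
  obtain ⟨K, C, hKc, hC, hKC, hKm⟩ := exists_kernel_of_contDiff hm
  refine ⟨C, hC, fun n hn q hq y => ?_⟩
  have hn' : (0 : ℝ) < n := by exact_mod_cast hn
  have hnc : (n : ℂ) ≠ 0 := by exact_mod_cast hn'.ne'
  obtain ⟨c, hc⟩ := exists_expSum_of_mem_trigPoly hq
  have hB := steklovDotDiff_of_eq_expSum hE (div_pos hγ hn') hc s
  have hBc := continuous_of_eq_expSum hB
  have hrep : ((iteratedDeriv s q y : ℝ) : ℂ) =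
      n ^ s * ∫ v : ℝ, ((steklovDotDiff (γ / n) s q (y - v / n) : ℝ) : ℂ) * K v := by
    rw [iteratedDeriv_of_eq_expSum hc]
    simp_rw [hB]
    rw [integral_expSum_mul_kernel (integrable_of_quadratic_decay hKc hKC) hKm hn,
      ← expSum_smul]
    congr 1; ext k
    have h3 : ((γ * (k / n : ℝ) : ℝ) * Complex.I : ℂ) = k * (γ / n : ℝ) * Complex.I := by
      push_cast; ring
    have h4 := hE0 (γ * (k / n : ℝ))
    have hγ' : (γ : ℂ) ≠ 0 := by exact_mod_cast hγ.ne'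
    simp only [Pi.smul_apply, smul_eq_mul, m]
    rw [← mul_assoc, ← mul_assoc, ← mul_pow, ← mul_pow]
    congr 2
    rw [h3] at h4 ⊢
    push_cast at h4 ⊢
    generalize E (k * (γ / n) * Complex.I) = e at h4 ⊢
    field_simp
  -- Boundedness makes the majorant integrable against `1/(1 + v²)`.
  have hb : ∃ M, ∀ x, ‖steklovDotDiff (γ / n) s q x‖ ≤ M := by
    refine ⟨∑ k ∈ Finset.Icc (-(n : ℤ)) n, ‖(-(k * (γ / n : ℝ) * Complex.I *
      E (k * (γ / n : ℝ) * Complex.I))) ^ s * c k‖, fun x => ?_⟩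
    rw [← Complex.norm_real, hB]
    refine (norm_sum_le _ _).trans (Finset.sum_le_sum fun k _ => ?_)
    have : (k * x * Complex.I : ℂ) = ((k * x : ℝ) : ℂ) * Complex.I := by push_cast; ring
    rw [norm_mul, this, Complex.norm_exp_ofReal_mul_I, mul_one]
  obtain ⟨M, hM⟩ := hb
  have hle : ‖∫ v : ℝ, ((steklovDotDiff (γ / n) s q (y - v / n) : ℝ) : ℂ) * K v‖ ≤
      C * ∫ v : ℝ, |steklovDotDiff (γ / n) s q (y - v / n)| * (1 + v ^ 2)⁻¹ := by
    rw [← integral_const_mul]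
    refine norm_integral_le_of_norm_le ?_ (Eventually.of_forall fun v => ?_)
    · refine Integrable.const_mul ?_ C
      refine integrable_inv_one_add_sq.bdd_mul (c := M) (Continuous.aestronglyMeasurable (by fun_prop)) ?_
      refine Eventually.of_forall fun v => ?_
      rw [Real.norm_eq_abs, abs_abs]
      exact hM _
    · rw [norm_mul, Complex.norm_real, Real.norm_eq_abs, mul_left_comm]
      exact mul_le_mul_of_nonneg_left (hKC v) (abs_nonneg _)
  have h5 := congrArg norm hrep
  rw [Complex.norm_real, norm_mul, norm_pow, Complex.norm_natCast, Real.norm_eq_abs] at h5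
  rw [h5, mul_comm C, mul_assoc]
  exact mul_le_mul_of_nonneg_left hle (by positivity)

end ExpSum

/-! ### Compatibility with the embedding of real-valued functions. -/

section LiftK

variable {𝕜 : Type*} [RCLike 𝕜]

theorem liftK_add (f g : ℝ → ℝ) : liftK 𝕜 (f + g) = liftK 𝕜 f + liftK 𝕜 g := by
  ext x; simp [liftK]

theorem liftK_sub (f g : ℝ → ℝ) : liftK 𝕜 (f - g) = liftK 𝕜 f - liftK 𝕜 g := by
  ext x; simp [liftK]

theorem liftK_smul (c : ℝ) (f : ℝ → ℝ) : liftK 𝕜 (c • f) = (c : 𝕜) • liftK 𝕜 f := by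
  ext x; simp [liftK]

theorem norm_liftK (f : ℝ → ℝ) (x : ℝ) : ‖liftK 𝕜 f x‖ = |f x| := by
  simp [liftK]

theorem steklov_liftK (h : ℝ) (f : ℝ → ℝ) : steklov h (liftK 𝕜 f) = liftK 𝕜 (steklov h f) := by
  ext x
  simp [steklov, liftK, intervalIntegral, integral_ofReal, RCLike.real_smul_eq_coe_mul]

theorem steklovDot_liftK (h : ℝ) (f : ℝ → ℝ) :
    steklovDot h (liftK 𝕜 f) = liftK 𝕜 (steklovDot h f) := by
  ext x
  simp only [steklovDot, steklov_liftK, liftK]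

theorem steklovDotDiff_liftK (h : ℝ) (s : ℕ) (f : ℝ → ℝ) :
    steklovDotDiff h s (liftK 𝕜 f) = liftK 𝕜 (steklovDotDiff h s f) := by
  induction s with
  | zero => rfl
  | succ s ih => rw [steklovDotDiff_succ, steklovDotDiff_succ, ih, steklovDot_liftK, liftK_sub]

theorem steklov_smul (h : ℝ) (c : 𝕜) (f : ℝ → 𝕜) : steklov h (c • f) = c • steklov h f := by
  ext x
  simp only [steklov, Pi.smul_apply, intervalIntegral.integral_smul]
  rw [smul_comm]

theorem liftK_mem_trigPoly {n : ℕ} {q : ℝ → ℝ} (hq : q ∈ trigPoly ℝ n) :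
    liftK 𝕜 q ∈ trigPoly 𝕜 n := by
  induction hq using Submodule.span_induction with
  | mem g hg =>
    obtain ⟨k, hk, hg⟩ := hg
    refine Submodule.subset_span ⟨k, hk, ?_⟩
    rcases hg with rfl | rfl
    · left; ext x; simp [liftK]
    · right; ext x; simp [liftK]
  | zero =>
    convert Submodule.zero_mem _
    ext x; simp [liftK]
  | add f g _ _ hf hg => rw [liftK_add]; exact Submodule.add_mem _ hf hg
  | smul a f _ hf => rw [liftK_smul]; exact Submodule.smul_mem _ _ hf

end LiftK

/-! ### Bounded measurable functions on the circle. -/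

section Circle

theorem circleMeasure_absolutelyContinuous : circleMeasure ≪ volume :=
  Measure.smul_absolutelyContinuous.trans Measure.restrict_le_self.absolutelyContinuous

/-- Translates of one period cover the line. Steklov averages integrate across period boundaries,
while the data give measurability on one period only. -/
theorem aestronglyMeasurable_of_periodic {f : ℝ → ℝ} (hp : Function.Periodic f (2 * Real.pi))
    (hf : AEStronglyMeasurable f circleMeasure) : AEStronglyMeasurable f volume := by
  have hpi : 0 < 2 * Real.pi := by positivity
  have h0 : AEStronglyMeasurable f (volume.restrict (Set.Ico (-Real.pi) Real.pi)) := by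
    refine hf.mono_ac (Measure.absolutelyContinuous_smul (ENNReal.inv_ne_zero.2 ENNReal.ofReal_ne_top))
  have hU := iUnion_Ico_add_zsmul hpi (-Real.pi)
  rw [← Measure.restrict_univ (μ := (volume : Measure ℝ)), ← hU, aestronglyMeasurable_iUnion_iff]
  intro k
  have hmp : MeasurePreserving (fun x : ℝ => x - k • (2 * Real.pi)) volume volume :=
    measurePreserving_sub_right volume _
  have h1 := hmp.restrict_preimage (s := Set.Ico (-Real.pi) Real.pi) measurableSet_Ico
  have h2 := h0.comp_measurePreserving h1
  have h3 : (fun x : ℝ => x - k • (2 * Real.pi)) ⁻¹' Set.Ico (-Real.pi) Real.pi =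
      Set.Ico (-Real.pi + k • (2 * Real.pi)) (-Real.pi + (k + 1) • (2 * Real.pi)) := by
    ext x
    simp only [Set.mem_preimage, Set.mem_Ico, zsmul_eq_mul]
    push_cast
    constructor <;> rintro ⟨h4, h5⟩ <;> constructor <;> linarith
  rw [h3] at h2
  refine h2.congr (Eventually.of_forall fun x => ?_)
  exact hp.sub_zsmul_eq k

/-- Bounded measurable functions on the circle. -/
structure IsBoundedOnCircle (f : ℝ → ℝ) : Prop where
  periodic : Function.Periodic f (2 * Real.pi)
  aesm : AEStronglyMeasurable f volume
  bdd : ∃ M, ∀ x, |f x| ≤ M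

namespace IsBoundedOnCircle

variable {f g : ℝ → ℝ}

theorem of_continuous (hp : Function.Periodic f (2 * Real.pi)) (hc : Continuous f) :
    IsBoundedOnCircle f := by
  refine ⟨hp, hc.aestronglyMeasurable, ?_⟩
  obtain ⟨M, hM⟩ := isCompact_Icc.exists_bound_of_continuousOn
    (s := Set.Icc 0 (2 * Real.pi)) hc.continuousOn
  refine ⟨M, fun x => ?_⟩
  obtain ⟨y, hy, hxy⟩ := hp.exists_mem_Ico₀ (by positivity) x
  rw [hxy]
  exact hM y (Set.Ico_subset_Icc_self hy)

theorem of_mem_trigPoly {n : ℕ} (hf : f ∈ trigPoly ℝ n) : IsBoundedOnCircle f := by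
  obtain ⟨c, hc⟩ := exists_expSum_of_mem_trigPoly hf
  exact of_continuous (periodic_of_eq_expSum hc) (continuous_of_eq_expSum hc)

theorem sub (hf : IsBoundedOnCircle f) (hg : IsBoundedOnCircle g) : IsBoundedOnCircle (f - g) := by
  obtain ⟨M, hM⟩ := hf.bdd
  obtain ⟨L, hL⟩ := hg.bdd
  refine ⟨hf.periodic.sub hg.periodic, hf.aesm.sub hg.aesm, M + L, fun x => ?_⟩
  exact (abs_sub _ _).trans (add_le_add (hM x) (hL x))

theorem abs (hf : IsBoundedOnCircle f) : IsBoundedOnCircle (fun x => |f x|) := by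
  obtain ⟨M, hM⟩ := hf.bdd
  exact ⟨fun x => by simp only [hf.periodic x], hf.aesm.norm, M, fun x => by simpa using hM x⟩

theorem aesm_circle (hf : IsBoundedOnCircle f) : AEStronglyMeasurable f circleMeasure :=
  hf.aesm.mono_ac circleMeasure_absolutelyContinuous

theorem intervalIntegrable (hf : IsBoundedOnCircle f) (a b : ℝ) :
    IntervalIntegrable f volume a b := by
  obtain ⟨M, hM⟩ := hf.bdd
  rw [intervalIntegrable_iff]
  exact Measure.integrableOn_of_bounded (M := M) (by simp) hf.aesm (Eventually.of_forall hM)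

theorem steklovDot {h : ℝ} (hf : IsBoundedOnCircle f) : IsBoundedOnCircle (steklovDot h f) := by
  refine of_continuous (fun x => ?_) ?_
  · rw [steklovDot_eq, steklovDot_eq, add_right_comm,
      ← intervalIntegral.integral_comp_add_right]
    congr 2; ext t; exact hf.periodic t
  · have h1 := intervalIntegral.continuous_primitive hf.intervalIntegrable 0
    have h2 : _root_.steklovDot h f =
        fun x => (1 / h : ℝ) • ((∫ t in (0:ℝ)..(x + h), f t) - ∫ t in (0:ℝ)..x, f t) := by
      ext x
      rw [steklovDot_eq, intervalIntegral.integral_interval_sub_left (hf.intervalIntegrable _ _)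
        (hf.intervalIntegrable _ _)]
    rw [h2]
    exact ((h1.comp (continuous_id.add continuous_const)).sub h1).const_smul (1 / h)

theorem steklovDotDiff {h : ℝ} (hf : IsBoundedOnCircle f) (s : ℕ) :
    IsBoundedOnCircle (steklovDotDiff h s f) := by
  induction s with
  | zero => exact hf
  | succ s ih => rw [steklovDotDiff_succ]; exact ih.sub ih.steklovDot

theorem steklovDot_sub {h : ℝ} (hf : IsBoundedOnCircle f) (hg : IsBoundedOnCircle g) :
    _root_.steklovDot h (f - g) = _root_.steklovDot h f - _root_.steklovDot h g := by
  ext x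
  simp only [Pi.sub_apply, steklovDot_eq]
  rw [intervalIntegral.integral_sub (hf.intervalIntegrable _ _) (hg.intervalIntegrable _ _),
    smul_sub]

theorem steklovDotDiff_sub {h : ℝ} (hf : IsBoundedOnCircle f) (hg : IsBoundedOnCircle g) (s : ℕ) :
    _root_.steklovDotDiff h s (f - g) =
      _root_.steklovDotDiff h s f - _root_.steklovDotDiff h s g := by
  induction s with
  | zero => rfl
  | succ s ih =>
    simp only [steklovDotDiff_succ, ih]
    rw [steklovDot_sub (hf.steklovDotDiff s) (hg.steklovDotDiff s)]
    abel

/-- The interval `[x, x + h]` is half of the centred interval `[x - h, x + h]`. This bounds the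
shifted average without translating in `X`. -/
theorem abs_steklovDot_le {h : ℝ} (hh : 0 < h) (hf : IsBoundedOnCircle f) (x : ℝ) :
    |_root_.steklovDot h f x| ≤ 2 * steklov (2 * h) (fun t => |f t|) x := by
  rw [steklovDot_eq, steklov, smul_eq_mul, smul_eq_mul, abs_mul, abs_of_pos (by positivity)]
  have h1 : |∫ t in x..(x + h), f t| ≤ ∫ t in x..(x + h), |f t| :=
    intervalIntegral.abs_integral_le_integral_abs (by linarith)
  have h2 : ∫ t in x..(x + h), |f t| ≤ ∫ t in (x - 2 * h / 2)..(x + 2 * h / 2), |f t| :=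
    intervalIntegral.integral_mono_interval (by linarith) (by linarith) (by linarith)
      (Eventually.of_forall fun t => abs_nonneg _) (hf.abs.intervalIntegrable _ _)
  have h3 : 1 / h * |∫ t in x..(x + h), f t| ≤
      1 / h * ∫ t in (x - 2 * h / 2)..(x + 2 * h / 2), |f t| :=
    mul_le_mul_of_nonneg_left (h1.trans h2) (by positivity)
  refine h3.trans_eq ?_
  field_simp

end IsBoundedOnCircle

end Circle

/-! ### The lattice norm on real-valued functions. -/

namespace BanachFunctionLattice

variable {𝕜 : Type*} [RCLike 𝕜] (X : BanachFunctionLattice 𝕜)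

/-- The norm of `X` on real-valued functions. -/
noncomputable def realNorm (f : ℝ → ℝ) : ℝ≥0∞ := X.eNorm (liftK 𝕜 f)

variable {X}

theorem realNorm_add_le (f g : ℝ → ℝ) : X.realNorm (f + g) ≤ X.realNorm f + X.realNorm g := by
  rw [realNorm, liftK_add]; exact X.eNorm_add_le' _ _

theorem realNorm_smul (c : ℝ) (f : ℝ → ℝ) : X.realNorm (c • f) = ENNReal.ofReal |c| * X.realNorm f := by
  rw [realNorm, liftK_smul, X.eNorm_smul', ← ofReal_norm, RCLike.norm_ofReal]; rfl

theorem realNorm_sub_le (f g : ℝ → ℝ) : X.realNorm (f - g) ≤ X.realNorm f + X.realNorm g := by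
  have h : f - g = f + (-1 : ℝ) • g := by ext x; simp [sub_eq_add_neg]
  have h1 := X.realNorm_add_le f ((-1 : ℝ) • g)
  rw [realNorm_smul] at h1
  rw [h]
  simpa using h1

/-- Extends solidity to every `g`: outside `X` the right side is `∞`. -/
theorem realNorm_mono {f g : ℝ → ℝ} (hp : Function.Periodic f (2 * Real.pi))
    (hf : AEStronglyMeasurable f circleMeasure) (hfg : ∀ x, |f x| ≤ |g x|) :
    X.realNorm f ≤ X.realNorm g := by
  by_cases hg : X.realNorm g < ∞
  · refine X.solid' _ _ (fun x => by simp only [liftK, hp x])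
      (RCLike.continuous_ofReal.comp_aestronglyMeasurable hf) hg (Eventually.of_forall fun x => ?_)
    simpa only [norm_liftK] using hfg x
  · rw [not_lt, top_le_iff] at hg
    rw [hg]; exact le_top

theorem realNorm_abs_le {f : ℝ → ℝ} (hf : IsBoundedOnCircle f) :
    X.realNorm (fun x => |f x|) ≤ X.realNorm f :=
  realNorm_mono hf.abs.periodic hf.abs.aesm_circle fun x => by simp

theorem realNorm_lt_top {f : ℝ → ℝ} (hf : IsBoundedOnCircle f) : X.realNorm f < ∞ := by
  obtain ⟨M, hM⟩ := hf.bdd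
  have h1 : X.realNorm (fun _ => (1 : ℝ)) < ∞ := by
    have h := (X.indicator' Set.univ (by simp) MeasurableSet.univ.nullMeasurableSet).1
    rw [Set.indicator_univ] at h
    have h1 : liftK 𝕜 (fun _ => (1 : ℝ)) = fun _ => 1 := by ext x; simp [liftK]
    rwa [realNorm, h1]
  have h2 : X.realNorm f ≤ X.realNorm (M • fun _ => (1 : ℝ)) := by
    refine realNorm_mono hf.periodic hf.aesm_circle fun x => ?_
    simpa using (hM x).trans (le_abs_self M)
  refine h2.trans_lt ?_
  rw [realNorm_smul]
  exact ENNReal.mul_lt_top ENNReal.ofReal_lt_top h1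

theorem SteklovBounded.exists_realNorm_le (hX : X.SteklovBounded) :
    ∃ C : ℝ≥0, 0 < C ∧ ∀ f : ℝ → ℝ, ∀ h : ℝ, 0 < h →
      X.realNorm (steklov h f) ≤ C * X.realNorm f := by
  obtain ⟨-, C, hC⟩ := hX
  -- The `+ 1` keeps the constant nonzero, so that the bound is `∞` when `f` has norm `∞`. For norm
  -- `0`, all multiples of `f` lie in the unit ball.
  refine ⟨C + 1, by positivity, fun f h hh => ?_⟩
  have key : ∀ r : ℝ≥0, r * X.realNorm f ≤ 1 → r * X.realNorm (steklov h f) ≤ C := by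
    intro r hr
    have h1 : ∀ g, X.realNorm ((r : ℝ) • g) = r * X.realNorm g := by
      intro g
      rw [realNorm_smul, abs_of_nonneg r.coe_nonneg, ENNReal.ofReal_coe_nnreal]
    have h2 := hC (liftK 𝕜 ((r : ℝ) • f)) (by rw [← h1] at hr; exact hr) h hh
    rw [steklov_liftK, steklov_smul] at h2
    rw [← h1]; exact h2
  have hCle : (C : ℝ≥0∞) ≤ (C + 1 : ℝ≥0) := by exact_mod_cast (by simp : C ≤ C + 1)
  rcases eq_or_ne (X.realNorm f) 0 with h0 | h0
  · have : X.realNorm (steklov h f) = 0 := by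
      by_contra hne
      obtain ⟨k, hk⟩ := ENNReal.exists_nat_mul_gt hne (ENNReal.coe_ne_top (r := C))
      have := key k (by simp [h0])
      exact absurd (by exact_mod_cast this) (not_le.2 hk)
    rw [this]; exact zero_le
  rcases eq_or_ne (X.realNorm f) ∞ with ht | ht
  · rw [ht, ENNReal.mul_top]
    · exact le_top
    · exact_mod_cast (by positivity : C + 1 ≠ 0)
  · have h1 := key (X.realNorm f).toNNReal⁻¹ (by
      rw [ENNReal.coe_inv (by simp [ENNReal.toNNReal_eq_zero_iff, h0, ht]), ENNReal.coe_toNNReal ht]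
      exact (ENNReal.inv_mul_cancel h0 ht).le)
    rw [ENNReal.coe_inv (by simp [ENNReal.toNNReal_eq_zero_iff, h0, ht]), ENNReal.coe_toNNReal ht,
      mul_comm, ← div_eq_mul_inv, ENNReal.div_le_iff h0 ht] at h1
    exact h1.trans (mul_le_mul_left hCle _)

/-- Each factor `I - Ȧ_h` costs `1 + 2C`, by the comparison with the centred average of `|g|` over
length `2h`. -/
theorem realNorm_steklovDotDiff_le {C : ℝ≥0} (hC : ∀ f : ℝ → ℝ, ∀ h : ℝ, 0 < h →
      X.realNorm (steklov h f) ≤ C * X.realNorm f) {h : ℝ} (hh : 0 < h) {f : ℝ → ℝ}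
    (hf : IsBoundedOnCircle f) (s : ℕ) :
    X.realNorm (steklovDotDiff h s f) ≤ ((1 + 2 * C) ^ s : ℝ≥0) * X.realNorm f := by
  induction s with
  | zero => simp [steklovDotDiff]
  | succ s ih =>
    have hg := hf.steklovDotDiff (h := h) s
    set g := steklovDotDiff h s f
    have h1 : X.realNorm (steklovDot h g) ≤ 2 * C * X.realNorm g := by
      calc X.realNorm (steklovDot h g)
          ≤ X.realNorm ((2 : ℝ) • steklov (2 * h) (fun t => |g t|)) :=
            realNorm_mono hg.steklovDot.periodic hg.steklovDot.aesm_circle fun x =>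
              (hg.abs_steklovDot_le hh x).trans (le_abs_self _)
        _ = 2 * X.realNorm (steklov (2 * h) (fun t => |g t|)) := by rw [realNorm_smul]; simp
        _ ≤ 2 * (C * X.realNorm g) := by
            gcongr
            exact (hC _ _ (by positivity)).trans (by gcongr; exact realNorm_abs_le hg)
        _ = _ := by ring
    rw [steklovDotDiff_succ]
    calc X.realNorm (g - steklovDot h g) ≤ X.realNorm g + 2 * C * X.realNorm g :=
          (realNorm_sub_le _ _).trans (by gcongr)
      _ = (1 + 2 * C) * X.realNorm g := by ring
      _ ≤ (1 + 2 * C) * (((1 + 2 * C) ^ s : ℝ≥0) * X.realNorm f) := by gcongr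
      _ = _ := by push_cast; ring

end BanachFunctionLattice

/-! ### Convolution with the kernel `1/(1 + v²)` at scale `1/n`. -/

section QuadraticKernel

variable {g : ℝ → ℝ} {n : ℕ}

theorem continuous_truncated_convolution (hg : Continuous g) (n : ℕ) (a : ℝ) :
    Continuous fun x => ∫ v in (-a)..a, g (x - v / n) * (1 + v ^ 2)⁻¹ := by
  refine intervalIntegral.continuous_parametric_intervalIntegral_of_continuous' ?_ _ _
  have h : Continuous fun p : ℝ × ℝ => (1 + p.2 ^ 2)⁻¹ :=
    Continuous.inv₀ (by fun_prop) fun p => by positivity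
  exact Continuous.mul (by fun_prop) h

theorem continuous_convolution_integrand (hg : Continuous g) (n : ℕ) (x : ℝ) :
    Continuous fun v : ℝ => g (x - v / n) * (1 + v ^ 2)⁻¹ :=
  Continuous.mul (by fun_prop) (Continuous.inv₀ (by fun_prop) fun p => by positivity)

theorem integrable_convolution (hg : IsBoundedOnCircle g) (hc : Continuous g) (n : ℕ) (x : ℝ) :
    Integrable fun v : ℝ => g (x - v / n) * (1 + v ^ 2)⁻¹ := by
  obtain ⟨M, hM⟩ := hg.bdd
  exact integrable_inv_one_add_sq.bdd_mul (c := M) (Continuous.aestronglyMeasurable (by fun_prop))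
    (Eventually.of_forall fun v => hM _)

theorem integral_dilate_eq_steklov (g : ℝ → ℝ) (hn : 1 ≤ n) {a : ℝ} (ha : 0 < a) (x : ℝ) :
    ∫ v in (-a)..a, g (x - v / n) = 2 * a * steklov (2 * a / n) g x := by
  have hn' : (0 : ℝ) < n := by exact_mod_cast hn
  rw [intervalIntegral.integral_comp_sub_div g hn'.ne', steklov, smul_eq_mul, smul_eq_mul]
  have h1 : x - 2 * a / n / 2 = x - a / n := by ring
  have h2 : x + 2 * a / n / 2 = x - -a / n := by ring
  rw [h1, h2]
  field_simp

/-- For `a ≤ |v| ≤ 2a` the kernel is at most `a⁻²`, and the integral over `|v| ≤ 2a` is `4a` times a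
Steklov average; hence `4/a`. -/
theorem truncated_convolution_double_le (hc : Continuous g) (h0 : ∀ x, 0 ≤ g x) (hn : 1 ≤ n)
    {a : ℝ} (ha : 0 < a) (x : ℝ) :
    ∫ v in (-(2 * a))..(2 * a), g (x - v / n) * (1 + v ^ 2)⁻¹ ≤
      (∫ v in (-a)..a, g (x - v / n) * (1 + v ^ 2)⁻¹) +
        4 / a * steklov (2 * (2 * a) / n) g x := by
  set F : ℝ → ℝ := fun v => g (x - v / n) * (1 + v ^ 2)⁻¹ with hF
  set G : ℝ → ℝ := fun v => g (x - v / n) with hG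
  have hFi : ∀ b c, IntervalIntegrable F volume b c := fun b c =>
    (continuous_convolution_integrand hc n x).intervalIntegrable b c
  have hGi : ∀ b c, IntervalIntegrable G volume b c := fun b c =>
    Continuous.intervalIntegrable (by fun_prop) b c
  have hle : ∀ v, a ≤ |v| → F v ≤ (a ^ 2)⁻¹ * G v := by
    intro v hv
    rw [hF, mul_comm (a ^ 2)⁻¹]
    refine mul_le_mul_of_nonneg_left ?_ (h0 _)
    refine inv_anti₀ (by positivity) ?_
    have := pow_le_pow_left₀ ha.le hv 2
    rw [sq_abs] at this
    linarith
  have e1 : ∫ v in (-(2 * a))..(2 * a), F v =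
      (∫ v in (-(2 * a))..(-a), F v) + (∫ v in (-a)..a, F v) + ∫ v in a..(2 * a), F v := by
    rw [intervalIntegral.integral_add_adjacent_intervals (hFi _ _) (hFi _ _),
      intervalIntegral.integral_add_adjacent_intervals (hFi _ _) (hFi _ _)]
  have e2 : ∫ v in (-(2 * a))..(2 * a), G v =
      (∫ v in (-(2 * a))..(-a), G v) + (∫ v in (-a)..a, G v) + ∫ v in a..(2 * a), G v := by
    rw [intervalIntegral.integral_add_adjacent_intervals (hGi _ _) (hGi _ _),
      intervalIntegral.integral_add_adjacent_intervals (hGi _ _) (hGi _ _)]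
  have i1 : ∫ v in (-(2 * a))..(-a), F v ≤ (a ^ 2)⁻¹ * ∫ v in (-(2 * a))..(-a), G v := by
    rw [← intervalIntegral.integral_const_mul]
    refine intervalIntegral.integral_mono_on (by linarith) (hFi _ _) ((hGi _ _).const_mul _) ?_
    intro v hv
    exact hle v (by rw [abs_of_nonpos (by linarith [hv.2])]; linarith [hv.2])
  have i2 : ∫ v in a..(2 * a), F v ≤ (a ^ 2)⁻¹ * ∫ v in a..(2 * a), G v := by
    rw [← intervalIntegral.integral_const_mul]
    refine intervalIntegral.integral_mono_on (by linarith) (hFi _ _) ((hGi _ _).const_mul _) ?_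
    intro v hv
    exact hle v (hv.1.trans (le_abs_self v))
  have i3 : 0 ≤ (a ^ 2)⁻¹ * ∫ v in (-a)..a, G v :=
    mul_nonneg (by positivity) (intervalIntegral.integral_nonneg (by linarith) fun v _ => h0 _)
  have e3 : 4 / a * steklov (2 * (2 * a) / n) g x =
      (a ^ 2)⁻¹ * ∫ v in (-(2 * a))..(2 * a), G v := by
    rw [hG, integral_dilate_eq_steklov g hn (by positivity)]
    field_simp
    ring
  rw [e3, e1, e2]
  linarith

/-- After the substitution `v ↦ v + δ`, `δ = n(y - x)`, `|δ| ≤ L`, it remains to compare kernels: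
`v² ≤ 2(v + δ)² + 2δ²`. -/
theorem convolution_shift_le (hg : IsBoundedOnCircle g) (hc : Continuous g) (h0 : ∀ x, 0 ≤ g x)
    (hn : 1 ≤ n) {L x y : ℝ} (hL : |y - x| ≤ L / n) :
    ∫ v : ℝ, g (y - v / n) * (1 + v ^ 2)⁻¹ ≤
      (2 + 2 * L ^ 2) * ∫ v : ℝ, g (x - v / n) * (1 + v ^ 2)⁻¹ := by
  have hn' : (0 : ℝ) < n := by exact_mod_cast hn
  have hδ : (n * (y - x)) ^ 2 ≤ L ^ 2 := by
    rw [le_div_iff₀ hn', mul_comm, ← abs_of_pos hn', ← abs_mul] at hL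
    rw [← sq_abs]
    exact pow_le_pow_left₀ (abs_nonneg _) hL 2
  rw [← integral_add_right_eq_self (fun v : ℝ => g (y - v / n) * (1 + v ^ 2)⁻¹) (n * (y - x)),
    ← integral_const_mul]
  have e : ∀ v : ℝ, y - (v + n * (y - x)) / n = x - v / n := by
    intro v; field_simp; ring
  refine integral_mono ((integrable_convolution hg hc n y).comp_add_right _)
    ((integrable_convolution hg hc n x).const_mul _) fun v => ?_
  simp only [e]
  rw [mul_left_comm]
  refine mul_le_mul_of_nonneg_left ?_ (h0 _)
  rw [← div_eq_mul_inv, inv_eq_one_div, div_le_div_iff₀ (by positivity) (by positivity)]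
  nlinarith [sq_nonneg (v + 2 * (n * (y - x))), sq_nonneg (L * (v + n * (y - x)))]

theorem periodic_convolution {μ : Measure ℝ} (hp : Function.Periodic g (2 * Real.pi)) (n : ℕ) :
    Function.Periodic (fun x => ∫ v : ℝ, g (x - v / n) * (1 + v ^ 2)⁻¹ ∂μ) (2 * Real.pi) := by
  intro x
  refine integral_congr_ae (Eventually.of_forall fun v => ?_)
  simp only [add_sub_right_comm, hp (x - v / n)]

end QuadraticKernel

/-! ### Convolution bounds in `X` and the Nikolskii–Stechkin inequality. -/

namespace BanachFunctionLattice

variable {𝕜 : Type*} [RCLike 𝕜] {X : BanachFunctionLattice 𝕜}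

/-- Induction over dyadic truncations: the start costs `2 = 10 - 8`, and the step adds `4/2^R =
8/2^R - 8/2^(R+1)`. -/
theorem realNorm_truncated_convolution_le {C : ℝ≥0} (hC : ∀ f : ℝ → ℝ, ∀ h : ℝ, 0 < h →
      X.realNorm (steklov h f) ≤ C * X.realNorm f) {g : ℝ → ℝ} (hg : IsBoundedOnCircle g)
    (hc : Continuous g) (h0 : ∀ x, 0 ≤ g x) {n : ℕ} (hn : 1 ≤ n) (R : ℕ) :
    X.realNorm (fun x => ∫ v in (-2 ^ R : ℝ)..2 ^ R, g (x - v / n) * (1 + v ^ 2)⁻¹) ≤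
      ENNReal.ofReal (10 - 8 / 2 ^ R) * (C * X.realNorm g) := by
  have hn' : (0 : ℝ) < n := by exact_mod_cast hn
  have hnn : ∀ (R : ℕ) x,
      0 ≤ ∫ v in (-2 ^ R : ℝ)..2 ^ R, g (x - v / n) * (1 + v ^ 2)⁻¹ := fun R x =>
    intervalIntegral.integral_nonneg (by linarith [show (0 : ℝ) < 2 ^ R by positivity])
      fun v _ => mul_nonneg (h0 _) (by positivity)
  have hper : ∀ R : ℕ, Function.Periodic
      (fun x => ∫ v in (-2 ^ R : ℝ)..2 ^ R, g (x - v / n) * (1 + v ^ 2)⁻¹) (2 * Real.pi) := by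
    intro R x
    simp only [add_sub_right_comm, hg.periodic _]
  have hmeas : ∀ R : ℕ, AEStronglyMeasurable
      (fun x => ∫ v in (-2 ^ R : ℝ)..2 ^ R, g (x - v / n) * (1 + v ^ 2)⁻¹) circleMeasure :=
    fun R => (continuous_truncated_convolution hc n _).aestronglyMeasurable
  have hst : ∀ (c a : ℝ), 0 ≤ c → 0 < a → X.realNorm (c • steklov (a / n) g) ≤
      ENNReal.ofReal c * (C * X.realNorm g) := by
    intro c a hc0 ha
    rw [realNorm_smul, abs_of_nonneg hc0]
    gcongr
    exact hC _ _ (by positivity)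
  induction R with
  | zero =>
    refine (realNorm_mono (g := (2 : ℝ) • steklov (2 / n) g) (hper 0) (hmeas 0)
      fun x => ?_).trans ((hst 2 2 (by norm_num) (by norm_num)).trans_eq (by norm_num))
    rw [abs_of_nonneg (hnn 0 x)]
    refine le_trans ?_ (le_abs_self _)
    have h1 := integral_dilate_eq_steklov g hn one_pos x
    rw [mul_one] at h1
    rw [Pi.smul_apply, smul_eq_mul, ← h1, pow_zero]
    refine intervalIntegral.integral_mono_on (by norm_num)
      ((continuous_convolution_integrand hc n x).intervalIntegrable _ _)
      (Continuous.intervalIntegrable (by fun_prop) _ _) fun v _ => ?_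
    exact mul_le_of_le_one_right (h0 _) (inv_le_one_of_one_le₀ (by nlinarith))
  | succ R ih =>
    refine (realNorm_mono (hper (R + 1)) (hmeas (R + 1)) (g :=
      (fun x => ∫ v in (-2 ^ R : ℝ)..2 ^ R, g (x - v / n) * (1 + v ^ 2)⁻¹) +
        (4 / 2 ^ R : ℝ) • steklov (2 * (2 * 2 ^ R) / n) g) fun x => ?_).trans
      ((realNorm_add_le _ _).trans ((add_le_add ih
        (hst (4 / 2 ^ R) _ (by positivity) (by positivity))).trans_eq ?_))
    · rw [abs_of_nonneg (hnn _ x)]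
      refine le_trans ?_ (le_abs_self _)
      have := truncated_convolution_double_le hc h0 hn (a := 2 ^ R) (by positivity) x
      rw [pow_succ']
      exact this
    · have h1 : (8 : ℝ) / 2 ^ R ≤ 8 := div_le_self (by norm_num) (one_le_pow₀ (by norm_num))
      rw [← add_mul, ← ENNReal.ofReal_add (by linarith) (by positivity)]
      congr 2
      rw [pow_succ]
      field_simp
      ring

/-- The truncations increase to the full convolution with uniformly bounded norms, so the Fatou
property passes to the limit. -/
theorem realNorm_convolution_le {C : ℝ≥0} (hC : ∀ f : ℝ → ℝ, ∀ h : ℝ, 0 < h →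
      X.realNorm (steklov h f) ≤ C * X.realNorm f) {g : ℝ → ℝ} (hg : IsBoundedOnCircle g)
    (hc : Continuous g) (h0 : ∀ x, 0 ≤ g x) {n : ℕ} (hn : 1 ≤ n) :
    X.realNorm (fun x => ∫ v : ℝ, g (x - v / n) * (1 + v ^ 2)⁻¹) ≤ 10 * C * X.realNorm g := by
  have hle : ∀ R : ℕ,
      X.realNorm (fun x => ∫ v in (-2 ^ R : ℝ)..2 ^ R, g (x - v / n) * (1 + v ^ 2)⁻¹) ≤
        10 * C * X.realNorm g := by
    intro R
    refine (realNorm_truncated_convolution_le hC hg hc h0 hn R).trans ?_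
    rw [mul_assoc]
    gcongr
    refine (ENNReal.ofReal_le_ofReal (q := 10) ?_).trans_eq (by norm_num)
    have : (0 : ℝ) ≤ 8 / 2 ^ R := by positivity
    linarith
  have h2 : Tendsto (fun R : ℕ => (2 : ℝ) ^ R) atTop atTop :=
    tendsto_pow_atTop_atTop_of_one_lt one_lt_two
  have hF := X.fatou' (fun R x => ∫ v in (-2 ^ R : ℝ)..2 ^ R, g (x - v / n) * (1 + v ^ 2)⁻¹)
    (fun x => ∫ v : ℝ, g (x - v / n) * (1 + v ^ 2)⁻¹)
    ((iSup_le hle).trans_lt (ENNReal.mul_lt_top (ENNReal.mul_lt_top (by simp) (by simp))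
      (realNorm_lt_top hg)))
    (periodic_convolution hg.periodic n)
    (Eventually.of_forall fun x => ⟨?_, ?_, ?_⟩)
  · exact le_of_tendsto' hF.2 hle
  · exact intervalIntegral.integral_nonneg (by norm_num) fun v _ =>
      mul_nonneg (h0 _) (by positivity)
  · intro R S hRS
    have h3 : (2 : ℝ) ^ R ≤ 2 ^ S := pow_le_pow_right₀ one_le_two hRS
    refine intervalIntegral.integral_mono_interval (by linarith)
      (by linarith [show (0 : ℝ) < 2 ^ R by positivity]) h3
      (Eventually.of_forall fun v => mul_nonneg (h0 _) (by positivity))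
      ((continuous_convolution_integrand hc n x).intervalIntegrable _ _)
  · exact intervalIntegral_tendsto_integral (integrable_convolution hg hc n x)
      (tendsto_neg_atTop_atBot.comp h2) h2

/-- An inequality of Nikolskii–Stechkin type for Steklov averages. -/
theorem SteklovBounded.exists_realNorm_iteratedDeriv_le (hX : X.SteklovBounded) {γ : ℝ}
    (hγ : 0 < γ) (s : ℕ) : ∃ C : ℝ≥0, ∀ n : ℕ, 1 ≤ n → ∀ q ∈ trigPoly ℝ n,
      X.realNorm (iteratedDeriv s q) ≤
        C * (n : ℝ≥0∞) ^ s * X.realNorm (steklovDotDiff (γ / n) s q) := by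
  obtain ⟨C₁, -, hC₁⟩ := hX.exists_realNorm_le
  obtain ⟨C, hC, hCq⟩ := exists_iteratedDeriv_le_integral hγ s
  refine ⟨C.toNNReal * (10 * C₁), fun n hn q hq => ?_⟩
  have hn' : (0 : ℝ) < n := by exact_mod_cast hn
  have hb := (IsBoundedOnCircle.of_mem_trigPoly hq).steklovDotDiff (h := γ / n) s
  obtain ⟨c, hc⟩ := exists_expSum_of_mem_trigPoly hq
  obtain ⟨E, -, hE, -⟩ := exists_exp_second_dslope
  have hcont := continuous_of_eq_expSum (steklovDotDiff_of_eq_expSum hE (div_pos hγ hn') hc s)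
  have hd := iteratedDeriv_of_eq_expSum hc s
  have h1 := realNorm_mono (X := X) (periodic_of_eq_expSum hd)
    (continuous_of_eq_expSum hd).aestronglyMeasurable (g := (C * n ^ s) • fun y =>
      ∫ v : ℝ, |steklovDotDiff (γ / n) s q (y - v / n)| * (1 + v ^ 2)⁻¹)
    fun y => (hCq n hn q hq y).trans (le_abs_self _)
  have h2 := realNorm_convolution_le hC₁ hb.abs hcont.abs (fun x => abs_nonneg _) hn
  rw [realNorm_smul, abs_of_nonneg (by positivity), ENNReal.ofReal_mul hC.le,
    ENNReal.ofReal_pow (by positivity), ENNReal.ofReal_natCast] at h1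
  calc X.realNorm (iteratedDeriv s q)
      ≤ ENNReal.ofReal C * n ^ s * (10 * C₁ * X.realNorm (steklovDotDiff (γ / n) s q)) :=
        h1.trans (by gcongr; exact h2.trans (by gcongr; exact realNorm_abs_le hb))
    _ = _ := by
        rw [ENNReal.ofReal]; push_cast; ring

end BanachFunctionLattice

/-! ### Arcs of the circle. -/

section Arc

theorem measurableSet_arc (a b : ℝ) : MeasurableSet (arc a b) := by
  have h : arc a b = ⋃ j : ℤ, (fun t : ℝ => t + j * (2 * Real.pi)) ⁻¹' Set.Ico a b := by
    ext t; simp only [arc, Set.mem_ofPred_eq, Set.mem_iUnion, Set.mem_preimage]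
  rw [h]
  exact MeasurableSet.iUnion fun j => (measurable_id.add_const _) measurableSet_Ico

theorem add_two_pi_mem_arc_iff (a b t : ℝ) : t + 2 * Real.pi ∈ arc a b ↔ t ∈ arc a b := by
  constructor
  · rintro ⟨j, hj⟩
    exact ⟨j + 1, by push_cast; convert hj using 1; ring⟩
  · rintro ⟨j, hj⟩
    exact ⟨j - 1, by push_cast; convert hj using 1; ring⟩

end Arc

/-! ### The discrete semi-norm and the sampling error. -/

namespace SamplingOperators

variable {𝕜 : Type*} [RCLike 𝕜] {X : BanachFunctionLattice 𝕜} (G : SamplingOperators X)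

theorem node_mono {n : ℕ} (hn : 1 ≤ n) {a b : ℕ} (ha : 1 ≤ a) (hab : a ≤ b) (hb : b ≤ G.m n + 1) :
    G.node n a ≤ G.node n b := by
  induction b, hab using Nat.le_induction with
  | base => exact le_rfl
  | succ b hab ih =>
    have h1 := (G.node_gap n hn b (Finset.mem_Icc.2 ⟨by omega, by omega⟩)).1
    have h2 : 0 ≤ G.γ / n := div_nonneg G.γ_pos.le (Nat.cast_nonneg n)
    linarith [ih (by omega)]

/-- All arcs lie over one period, so representatives of `t` in two of them differ by less than `2π`,
hence coincide; the ordering of the nodes then excludes a common point. -/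
theorem not_mem_arc_of_lt {n : ℕ} (hn : 1 ≤ n) {k l : ℕ} (hk : 1 ≤ k) (hkl : k < l)
    (hl : l ≤ G.m n) {t : ℝ} (htk : t ∈ arc (G.node n k) (G.node n (k + 1))) :
    t ∉ arc (G.node n l) (G.node n (l + 1)) := by
  rintro ⟨i, hi⟩
  obtain ⟨j, hj⟩ := htk
  have h1 := G.node_mono hn le_rfl hk (by omega)
  have h2 := G.node_mono hn (a := k + 1) (b := l) (by omega) (by omega) (by omega)
  have h3 := G.node_mono hn (a := l + 1) (by omega) (show l + 1 ≤ G.m n + 1 by omega) le_rfl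
  rw [G.node_wrap n hn] at h3
  have hpi := Real.pi_pos
  have h4 : (i : ℝ) - j < 1 := by nlinarith [hi.1, hi.2, hj.1, hj.2]
  have h5 : (j : ℝ) - i < 1 := by nlinarith [hi.1, hi.2, hj.1, hj.2]
  have h6 : i = j := by
    have h4' : i - j < 1 := by exact_mod_cast h4
    have h5' : j - i < 1 := by exact_mod_cast h5
    omega
  subst h6
  linarith [hi.1, hj.2]

theorem sum_arc_indicator_le {n : ℕ} (hn : 1 ≤ n) {a : ℕ → ℝ} {t B : ℝ} (hB : 0 ≤ B)
    (h : ∀ k ∈ Finset.Icc 1 (G.m n), t ∈ arc (G.node n k) (G.node n (k + 1)) → a k ≤ B) :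
    ∑ k ∈ Finset.Icc 1 (G.m n),
      (arc (G.node n k) (G.node n (k + 1))).indicator (fun _ => a k) t ≤ B := by
  by_cases hex : ∃ k ∈ Finset.Icc 1 (G.m n), t ∈ arc (G.node n k) (G.node n (k + 1))
  · obtain ⟨k, hk, htk⟩ := hex
    rw [Finset.sum_eq_single_of_mem k hk, Set.indicator_of_mem htk]
    · exact h k hk htk
    · intro l hl hlk
      refine Set.indicator_of_notMem ?_ _
      rw [Finset.mem_Icc] at hk hl
      rcases lt_or_gt_of_ne hlk with hlt | hlt
      · exact fun htl => G.not_mem_arc_of_lt hn hl.1 hlt hk.2 htl htk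
      · exact G.not_mem_arc_of_lt hn hk.1 hlt hl.2 htk
  · push Not at hex
    rw [Finset.sum_eq_zero fun k hk => Set.indicator_of_notMem (hex k hk) _]
    exact hB

/-- An inequality of Marcinkiewicz–Zygmund type: the discrete semi-norm of any function dominated
by a trigonometric polynomial `T` is at most a constant times the norm of `T`. -/
theorem exists_nodeNorm_le (hX : X.SteklovBounded) : ∃ C : ℝ≥0, ∀ n : ℕ, 1 ≤ n →
    ∀ T ∈ trigPoly ℝ n, ∀ u : ℝ → ℝ, (∀ x, |u x| ≤ |T x|) →
      G.nodeNorm n (liftK 𝕜 u) ≤ C * X.realNorm T := by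
  obtain ⟨C₁, -, hC₁⟩ := hX.exists_realNorm_le
  -- For `s = 0` no difference operator remains, so the step parameter is immaterial and `1` serves.
  obtain ⟨C, hC, hCq⟩ := exists_iteratedDeriv_le_integral one_pos 0
  refine ⟨C.toNNReal * (2 + 2 * G.γ' ^ 2).toNNReal * (10 * C₁), fun n hn T hT u hu => ?_⟩
  have hb := IsBoundedOnCircle.of_mem_trigPoly hT
  obtain ⟨c, hc⟩ := exists_expSum_of_mem_trigPoly hT
  have hcont := continuous_of_eq_expSum hc
  have hpt : ∀ t, |∑ k ∈ Finset.Icc 1 (G.m n), (arc (G.node n k) (G.node n (k + 1))).indicator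
      (fun _ => |u (G.node n k)|) t| ≤ |((C * (2 + 2 * G.γ' ^ 2)) • fun y : ℝ =>
        ∫ v : ℝ, |T (y - v / n)| * (1 + v ^ 2)⁻¹) t| := by
    intro t
    have hnn : 0 ≤ ∫ v : ℝ, |T (t - v / n)| * (1 + v ^ 2)⁻¹ :=
      integral_nonneg fun v => mul_nonneg (abs_nonneg _) (by positivity)
    rw [abs_of_nonneg (Finset.sum_nonneg fun k _ => Set.indicator_nonneg (fun _ _ => abs_nonneg _) _)]
    refine le_trans ?_ (le_abs_self _)
    refine G.sum_arc_indicator_le hn (mul_nonneg (by positivity) hnn) fun k hk ⟨j, hj⟩ => ?_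
    have hgap := (G.node_gap n hn k hk).2
    -- The node is moved by `2πj` to within `γ'/n` of `t`, so the shift estimate applies with `L =
    -- γ'`.
    have hT' : T (G.node n k) = T (G.node n k - j * (2 * Real.pi)) :=
      (hb.periodic.sub_int_mul_eq j).symm
    have h1 := hCq n hn T hT (G.node n k - j * (2 * Real.pi))
    rw [iteratedDeriv_zero, pow_zero, mul_one, ← hT'] at h1
    refine (hu _).trans (h1.trans ?_)
    rw [Pi.smul_apply, smul_eq_mul, mul_assoc]
    refine mul_le_mul_of_nonneg_left ?_ hC.le
    refine convolution_shift_le hb.abs hcont.abs (fun x => abs_nonneg _) hn ?_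
    rw [abs_le]
    constructor <;> linarith [hj.1, hj.2]
  have h1 : G.nodeNorm n (liftK 𝕜 u) ≤ X.realNorm ((C * (2 + 2 * G.γ' ^ 2)) • fun y : ℝ =>
      ∫ v : ℝ, |T (y - v / n)| * (1 + v ^ 2)⁻¹) := by
    unfold nodeNorm
    simp only [norm_liftK]
    refine BanachFunctionLattice.realNorm_mono (fun t => ?_) ?_ hpt
    · refine Finset.sum_congr rfl fun k _ => ?_
      exact Set.indicator_eq_indicator (add_two_pi_mem_arc_iff _ _ t) rfl
    · exact (Finset.measurable_sum _ fun k _ =>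
        measurable_const.indicator (measurableSet_arc _ _)).aestronglyMeasurable
  have h2 := BanachFunctionLattice.realNorm_convolution_le hC₁ hb.abs hcont.abs
    (fun x => abs_nonneg _) hn
  rw [BanachFunctionLattice.realNorm_smul, abs_of_nonneg (by positivity), ENNReal.ofReal_mul hC.le] at h1
  calc G.nodeNorm n (liftK 𝕜 u)
      ≤ ENNReal.ofReal C * ENNReal.ofReal (2 + 2 * G.γ' ^ 2) * (10 * C₁ * X.realNorm T) :=
        h1.trans (by gcongr; exact h2.trans (by gcongr; exact BanachFunctionLattice.realNorm_abs_le hb))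
    _ = _ := by
        rw [ENNReal.ofReal, ENNReal.ofReal]; push_cast; ring

theorem op_sub (n : ℕ) (f g : ℝ → 𝕜) : G.op n (f - g) = G.op n f - G.op n g := by
  ext x
  simp [op, sub_mul, Finset.sum_sub_distrib]

/-- One-sided trigonometric bounds `q ≤ f ≤ Q` reduce the sampling error of `f` to that of `q`. -/
theorem Stable.exists_error_le (hG : G.Stable) (hX : X.SteklovBounded) : ∃ C : ℝ≥0,
    ∀ f : ℝ → ℝ, IsBoundedOnCircle f → ∀ n : ℕ, 1 ≤ n → ∀ Q ∈ trigPoly ℝ n, ∀ q ∈ trigPoly ℝ n,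
      (∀ x, q x ≤ f x ∧ f x ≤ Q x) →
      X.eNorm (liftK 𝕜 f - G.op n (liftK 𝕜 f)) ≤
        C * X.realNorm (Q - q) + X.eNorm (liftK 𝕜 q - G.op n (liftK 𝕜 q)) := by
  obtain ⟨K, -, hK⟩ := hG
  obtain ⟨C, hC⟩ := G.exists_nodeNorm_le hX
  refine ⟨1 + K * C, fun f hf n hn Q hQ q hq hqf => ?_⟩
  have hqb := IsBoundedOnCircle.of_mem_trigPoly hq
  have hle : ∀ x, |(f - q) x| ≤ |(Q - q) x| := fun x => by
    rw [Pi.sub_apply, Pi.sub_apply, abs_of_nonneg (by linarith [(hqf x).1]),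
      abs_of_nonneg (by linarith [(hqf x).1, (hqf x).2])]
    linarith [(hqf x).2]
  have hle' : ∀ x, |(q - f) x| ≤ |(Q - q) x| := fun x => by
    rw [← abs_neg]; simpa using hle x
  -- The last term sees `q - f` only at the nodes, where the everywhere-valid bound by `Q - q` is
  -- essential.
  have e : liftK 𝕜 f - G.op n (liftK 𝕜 f) = liftK 𝕜 (f - q) +
      (liftK 𝕜 q - G.op n (liftK 𝕜 q)) + G.op n (liftK 𝕜 (q - f)) := by
    rw [liftK_sub, liftK_sub, op_sub]; abel
  have h1 : X.eNorm (liftK 𝕜 (f - q)) ≤ X.realNorm (Q - q) :=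
    BanachFunctionLattice.realNorm_mono (hf.sub hqb).periodic (hf.sub hqb).aesm_circle hle
  have h2 : X.eNorm (G.op n (liftK 𝕜 (q - f))) ≤ K * (C * X.realNorm (Q - q)) :=
    (hK n hn _ (BanachFunctionLattice.realNorm_lt_top (hqb.sub hf))).trans
      (by gcongr; exact hC n hn _ (Submodule.sub_mem _ hQ hq) _ hle')
  rw [e]
  refine (X.eNorm_add_le' _ _).trans ((add_le_add ((X.eNorm_add_le' _ _).trans
    (add_le_add h1 le_rfl)) h2).trans_eq ?_)
  push_cast
  ring

/-- Rewriting the goal as `a/C - b ≤ inf` with truncated subtraction allows passage to the infimum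
even when `b = ∞`. -/
theorem le_mul_oneSidedError_add {a b : ℝ≥0∞} {C : ℝ≥0} (hC : 0 < C) {n : ℕ} {f : ℝ → ℝ}
    (h : ∀ Q ∈ trigPoly ℝ n, ∀ q ∈ trigPoly ℝ n, (∀ x, q x ≤ f x ∧ f x ≤ Q x) →
      a ≤ C * (X.realNorm (Q - q) + b)) :
    a ≤ C * (X.oneSidedError n f + b) := by
  have hC0 : (C : ℝ≥0∞) ≠ 0 := by exact_mod_cast hC.ne'
  rw [mul_comm, ← ENNReal.div_le_iff hC0 ENNReal.coe_ne_top, ← tsub_le_iff_right]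
  refine le_iInf₂ fun Q hQ => le_iInf₂ fun q hq => le_iInf fun hqf => ?_
  rw [tsub_le_iff_right, ENNReal.div_le_iff hC0 ENNReal.coe_ne_top, mul_comm]
  exact h Q hQ q hq hqf

end SamplingOperators

/-! ### The error estimates. -/

theorem theorem3p6 {𝕜 : Type*} [RCLike 𝕜] (X : BanachFunctionLattice 𝕜)
    (hX : X.SteklovBounded) (G : SamplingOperators X) (hG : G.Stable) :
    (∀ s : ℕ, 1 ≤ s → G.PolyAccurate s →
      ∃ C : ℝ≥0, 0 < C ∧ ∀ f : ℝ → ℝ, Function.Periodic f (2 * Real.pi) →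
        AEStronglyMeasurable f circleMeasure → (∃ M : ℝ, ∀ x, |f x| ≤ M) →
        ∀ n : ℕ, 1 ≤ n →
          X.eNorm (liftK 𝕜 f - G.op n (liftK 𝕜 f)) ≤
            C * (X.oneSidedError n f + X.eNorm (steklovDotDiff (G.γ / n) s (liftK 𝕜 f)))) ∧
    (G.Reproduces →
      ∃ C : ℝ≥0, 0 < C ∧ ∀ f : ℝ → ℝ, Function.Periodic f (2 * Real.pi) →
        AEStronglyMeasurable f circleMeasure → (∃ M : ℝ, ∀ x, |f x| ≤ M) →
        ∀ n : ℕ, 1 ≤ n →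
          X.eNorm (liftK 𝕜 f - G.op n (liftK 𝕜 f)) ≤ C * X.oneSidedError n f) := by
  obtain ⟨C, hC⟩ := SamplingOperators.Stable.exists_error_le G hG hX
  constructor
  · rintro s - ⟨K, -, hK⟩
    obtain ⟨S, -, hS⟩ := hX.exists_realNorm_le
    obtain ⟨D, hD⟩ := hX.exists_realNorm_iteratedDeriv_le G.γ_pos s
    refine ⟨1 + C + K * D * (1 + (1 + 2 * S) ^ s), by positivity, fun f hp hm hb n hn => ?_⟩
    have hf : IsBoundedOnCircle f := ⟨hp, aestronglyMeasurable_of_periodic hp hm, hb⟩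
    have hh : 0 < G.γ / n := div_pos G.γ_pos (by exact_mod_cast hn)
    refine SamplingOperators.le_mul_oneSidedError_add (by positivity) fun Q hQ q hq hqf => ?_
    have hqb := IsBoundedOnCircle.of_mem_trigPoly hq
    obtain ⟨c, hc⟩ := exists_expSum_of_mem_trigPoly hq
    have hfq : X.realNorm (f - q) ≤ X.realNorm (Q - q) :=
      BanachFunctionLattice.realNorm_mono (hf.sub hqb).periodic (hf.sub hqb).aesm_circle fun x => by
        rw [Pi.sub_apply, Pi.sub_apply, abs_of_nonneg (by linarith [(hqf x).1]),
          abs_of_nonneg (by linarith [(hqf x).1, (hqf x).2])]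
        linarith [(hqf x).2]
    rw [steklovDotDiff_liftK]
    change _ ≤ _ * (_ + X.realNorm (steklovDotDiff (G.γ / n) s f))
    set A := X.realNorm (Q - q)
    set B := X.realNorm (steklovDotDiff (G.γ / n) s f) with hB
    -- Passage from `q` to `f`: the difference operator on `f - q` is bounded, and `|f - q| ≤ Q -
    -- q`.
    have h1 : X.realNorm (steklovDotDiff (G.γ / n) s q) ≤ B + ((1 + 2 * S) ^ s : ℝ≥0) * A := by
      have e : steklovDotDiff (G.γ / n) s q =
          steklovDotDiff (G.γ / n) s f - steklovDotDiff (G.γ / n) s (f - q) := by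
        rw [hf.steklovDotDiff_sub hqb]; abel
      rw [e]
      refine (BanachFunctionLattice.realNorm_sub_le _ _).trans (add_le_add le_rfl ?_)
      exact (BanachFunctionLattice.realNorm_steklovDotDiff_le hS hh (hf.sub hqb) s).trans
        (by gcongr)
    have h2 : X.eNorm (liftK 𝕜 q - G.op n (liftK 𝕜 q)) ≤
        K * D * (B + ((1 + 2 * S) ^ s : ℝ≥0) * A) := by
      have h3 := hK n hn _ (liftK_mem_trigPoly (𝕜 := 𝕜) hq)
      rw [iteratedDeriv_liftK hc] at h3
      have hn0 : (n : ℝ≥0∞) ^ s ≠ 0 := pow_ne_zero _ (by exact_mod_cast (by omega : n ≠ 0))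
      have hnt : (n : ℝ≥0∞) ^ s ≠ ∞ := ENNReal.pow_ne_top (ENNReal.natCast_ne_top n)
      calc X.eNorm (liftK 𝕜 q - G.op n (liftK 𝕜 q))
          ≤ K * ((n : ℝ≥0∞) ^ s)⁻¹ * (D * (n : ℝ≥0∞) ^ s *
              (B + ((1 + 2 * S) ^ s : ℝ≥0) * A)) :=
            h3.trans (by gcongr; exact (hD n hn q hq).trans (by gcongr))
        _ = K * D * (((n : ℝ≥0∞) ^ s)⁻¹ * (n : ℝ≥0∞) ^ s) *
              (B + ((1 + 2 * S) ^ s : ℝ≥0) * A) := by ring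
        _ = _ := by rw [ENNReal.inv_mul_cancel hn0 hnt, mul_one]
    refine (hC f hf n hn Q hQ q hq hqf).trans ((add_le_add le_rfl h2).trans ?_)
    push_cast
    set P : ℝ≥0∞ := (1 + 2 * (S : ℝ≥0∞)) ^ s
    -- The added terms are exactly those missing from the expansion of the final product.
    calc C * A + K * D * (B + P * A)
        ≤ C * A + K * D * (B + P * A) + (A + B + C * B + K * D * A + K * D * P * B) :=
          le_self_add
      _ = _ := by ring
  · intro hR
    refine ⟨1 + C, by positivity, fun f hp hm hb n hn => ?_⟩
    have hf : IsBoundedOnCircle f := ⟨hp, aestronglyMeasurable_of_periodic hp hm, hb⟩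
    -- The infimum lemma is applied with `b = 0`.
    rw [← add_zero (X.oneSidedError n f)]
    refine SamplingOperators.le_mul_oneSidedError_add (by positivity) fun Q hQ q hq hqf => ?_
    refine (hC f hf n hn Q hQ q hq hqf).trans ?_
    have h0 : X.eNorm 0 = 0 := by simpa using X.eNorm_smul' 0 0
    rw [hR n hn _ (liftK_mem_trigPoly hq), sub_self, h0, add_zero, add_zero]
    gcongr
    exact_mod_cast (by simp : C ≤ 1 + C)
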